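/- **Conventions.** A function $h:\mathbb R\to\mathbb C$ is *quasi-periodic* if $h(t)=\sum_{m\in\mathbb Z^A}H_m e^{i\,m\cdot\omega\,t}$ for some $A\ge 1$, some $\omega\in(0,\infty)^A$ and some absolutely summable coefficients $H_m\in\mathbb C$. Its mean value is $M(h)=\lim_{T\to\infty}\frac1{2T}\int_{-T}^{T}h(t)\,dt$. For functions $a,b,c,d$ on $\mathbb R$ put $$(a|b)(t)=a(t)\int_0^t\big(b(\tau)-M(b)\big)d\tau,\qquad (a|b|c)=(a|(b|c)),\qquad (a|b|c|d)=(a|(b|c|d)).$$ **Hypotheses.** Let $f:\mathbb R\to\mathbb R$ be quasi-periodic, $f(t)=\sum_{m\in\mathbb Z^A}F_me^{i\,m\cdot\omega\,t}$ with $\omega\in\mathbb R^A$ and $\sum_m|F_m|<\infty$, and let its small divisors be controlled in the following sense: there is a weight $w:\mathbb Z^A\to[1,\infty)$ with $w(-m)=w(m)$ and $w(m+n)\le w(m)w(n)$ such that $\sum_m|F_m|\,w(m)^N<\infty$ for every $N\in\mathbb N$, and such that for every $m\in\mathbb Z^A$ each of the numbers $m\cdot\omega$ and $m\cdot\omega+2M(f)$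 is either $0$ or at least $1/w(m)$ in absolute value. (For periodic $f$ with absolutely convergent Fourier series this always holds, with $w$ constant; if the numbers satisfy a Diophantine condition of exponent $\sigma\ge0$ it holds with $w(m)=C(1+|m|)^\sigma$ as soon as $F_m$ decays rapidly, in particular if it decays exponentially or has finite support.) Let $$q(t)=\exp\Big(i\int_0^tf\Big),\quad Q_0=q^2,\quad Q_1=(Q_0|Q_0^{-1}),\quad Q_2=(Q_0|Q_0),\quad Q_3=(Q_0|Q_1),$$ and assume condition (III): $M(Q_0)=M(Q_1)=0$ but $\mu:=M(Q_3)\ne0$. For a sequence of constants $\kappa_n\in\mathbb C$, $n\ge1$, let $$v_1=\kappa_1q,\qquad v_2(t)=q(t)\Big[i\int_0^t\big(\kappa_1^2Q_0-Q_0^{-1}\big)d\tau+\kappa_2\Big],\qquad v_n(t)=q(t)\Big[i\int_0^t\sum_{p=1}^{n-1}v_pv_{n-p}\,d\tau+\kappa_n\Big]\quad(n\ge3),$$ and $l_m(t)=i\,q(t)^2\int_0^t\sum_{p=1}^{m-1}v_pv_{m-p}\,d\tau$. Put $s=-Q_0^{-1}(\kappa_1^2Q_2-Q_1)^2$ and $$\mathcal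 A_1=-4\kappa_1^4(Q_0|Q_0|Q_2)+4\kappa_1^2(Q_0|Q_0|Q_1)+(Q_0|s),$$ $$\begin{aligned}\mathcal A_2={}&8\kappa_1^6(Q_0|Q_2|Q_2)-8\kappa_1^4(Q_0|Q_2|Q_1)-8i\kappa_1^4\kappa_2(Q_0|Q_2|Q_0)-8\kappa_1^4(Q_0|Q_1|Q_2)+8\kappa_1^2(Q_0|Q_1|Q_1)\\&+8i\kappa_1^2\kappa_2(Q_0|Q_1|Q_0)+16i\kappa_1^2\kappa_2(Q_0|Q_0|Q_1)-32i\kappa_1^4\kappa_2(Q_0|Q_0|Q_2)-12\kappa_1^2\kappa_2^2(Q_0|Q_2)-4\kappa_1^2(Q_0|\mathcal A_1),\end{aligned}$$ $$\begin{aligned}\mathcal A_3={}&8\kappa_1^6(Q_2|Q_0|Q_2)-8\kappa_1^4(Q_2|Q_0|Q_1)-8i\kappa_1^4\kappa_2(Q_2|Q_0|Q_0)-8\kappa_1^4(Q_1|Q_0|Q_2)+8\kappa_1^2(Q_1|Q_0|Q_1)\\&+8i\kappa_1^2\kappa_2(Q_1|Q_0|Q_0)-8i\kappa_1^4\kappa_2(Q_0|Q_0|Q_2)+8i\kappa_1^2\kappa_2(Q_0|Q_0|Q_1)-8\kappa_1^2\kappa_2^2(Q_0|Q_0|Q_0)\\&-2\kappa_1^2(Q_2|v_2^2)+2(Q_1|v_2^2)+2i\kappa_2(Q_0|v_2^2),\end{aligned}$$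 $$\mathcal A_4=Q_0^{-1}\big[i\kappa_1^3(Q_0|Q_2)-i\kappa_1(Q_0|Q_1)+\kappa_1\kappa_2Q_2\big]^2,$$ and, for $n\ge7$, $$\begin{aligned}\mathcal R^{(1)}_n={}&2i\kappa_1\sum_{p=1}^{n-4}\Big\{-2\kappa_1^2M(Q_0|Q_0|Q_0|v_pv_{n-3-p})+M(Q_0|Q_1|v_pv_{n-3-p})-\kappa_1^2M(Q_0|Q_2|v_pv_{n-3-p})\\&\qquad+i\kappa_2M(Q_0|Q_0|v_pv_{n-3-p})\Big\}-2\kappa_1^2\sum_{p=2}^{n-4}M(Q_0|Q_0|v_pv_{n-2-p})+i\kappa_1\sum_{p=3}^{n-4}M(Q_0|v_pv_{n-1-p}),\end{aligned}$$ $$\mathcal R^{(2)}_n=-2\kappa_1\sum_{p=1}^{n-4}M(qv_2|Q_0|v_pv_{n-3-p})+i\sum_{p=2}^{n-4}M(qv_2|v_pv_{n-2-p}).$$ Consider the recursive choice $$(*)\qquad\begin{gathered}\kappa_1^2=\frac{\overline{\mu}}{\mu},\qquad\kappa_2=-\frac{iM(\mathcal A_1)}{2\mu},\qquad\kappa_3=\frac{4M(\mathcal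 A_4)-M(\mathcal A_3)-M(\mathcal A_2)}{4\kappa_1\mu},\\\kappa_{n-3}=\frac{-1}{4\kappa_1\mu}\Big\{\sum_{p=4}^{n-4}M(v_pv_{n-p})+2\mathcal R^{(1)}_n+2\mathcal R^{(2)}_n+2M(q^{-1}v_3\,l_{n-3})\Big\}\quad(n\ge7).\end{gathered}$$ **Theorem.** For either square root $\kappa_1$ of $\overline\mu/\mu$ there are constants $\kappa_n$, $n\ge1$, beginning with this $\kappa_1$ and satisfying $(*)$. For every sequence satisfying $(*)$ one has $|\kappa_1|=1$ and all functions $v_n$, $n\ge1$, are quasi-periodic. Moreover $g=q\sum_{n\ge1}v_n\varepsilon^n$ is a formal power series solution of the generalised Riccati equation $\dot g-ig^2-2ifg+i\varepsilon^2=0$; that is, with $g_n=qv_n$, $$\dot g_n=i\sum_{p=1}^{n-1}g_pg_{n-p}+2if\,g_n-i\,\delta_{n,2}\qquad(n\ge1).$$ -/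

import Mathlib

open Filter Topology

noncomputable section

namespace QPRiccati

/-! ### Quasi-periodic functions and mean values -/

/-- The frequency `m · ω`, for `m ∈ ℤ^A`. -/
def freq {A : ℕ} (ω : Fin A → ℝ) (m : Fin A → ℤ) : ℝ := ∑ j, (m j : ℝ) * ω j

/-- `h(t) = ∑_m H_m exp(i (m · ω) t)` for all `t`, with absolutely summable coefficients `H`. -/
structure HasFourierExpansion {A : ℕ} (h : ℝ → ℂ) (ω : Fin A → ℝ) (H : (Fin A → ℤ) → ℂ) :
    Prop where
  summable : Summable fun m => ‖H m‖
  hasSum : ∀ t : ℝ, HasSum (fun m => H m * Complex.exp (Complex.I * (freq ω m : ℂ) * (t : ℂ))) (h t)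

/-- Quasi-periodic functions: absolutely convergent Fourier series with frequencies `m · ω`,
where `ω` is a vector of finitely many (at least one) positive basic frequencies. -/
def IsQuasiPeriodic (h : ℝ → ℂ) : Prop :=
  ∃ (A : ℕ) (ω : Fin A → ℝ) (H : (Fin A → ℤ) → ℂ),
    0 < A ∧ (∀ j, 0 < ω j) ∧ HasFourierExpansion h ω H

/-- The mean value `M(h) = lim_{T → ∞} (1 / 2T) ∫_{-T}^{T} h(t) dt`. -/
def mean (h : ℝ → ℂ) : ℂ :=
  limUnder atTop fun T : ℝ => (1 / (2 * (T : ℂ))) * ∫ t in (-T)..T, h t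

/-- Control of the small divisors of `f = ∑_m F_m exp(i (m · ω) t)` by a weight `w ≥ 1` on `ℤ^A`
which is even and submultiplicative: the nonzero ones among the numbers `m · ω` and
`m · ω + 2 M(f)` are at least `1 / w(m)` in absolute value, and the coefficients `F_m` decay
faster than every power of `1 / w`. For periodic `f` (`A = 1`) a constant weight will do, so that
nothing is required beyond the absolute summability of `F`; under a Diophantine condition
`w(m) = C (1 + |m|)^σ` will do if `F` decays rapidly (in particular if it is finitely supported or
decays exponentially). -/
structure SmallDivisorControl {A : ℕ} (f : ℝ → ℝ) (ω : Fin A → ℝ) (F : (Fin A → ℤ) → ℂ)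
    (w : (Fin A → ℤ) → ℝ) : Prop where
  one_le : ∀ m, 1 ≤ w m
  even : ∀ m, w (-m) = w m
  submul : ∀ m n, w (m + n) ≤ w m * w n
  decay : ∀ N : ℕ, Summable fun m => ‖F m‖ * w m ^ N
  divisor : ∀ m, freq ω m ≠ 0 → 1 / w m ≤ |freq ω m|
  divisor_mean : ∀ m, (freq ω m : ℂ) + 2 * mean (fun t => (f t : ℂ)) ≠ 0 →
    1 / w m ≤ ‖(freq ω m : ℂ) + 2 * mean (fun t => (f t : ℂ))‖

/-! ### The renormalised brackets and the functions `q`, `Q₀`, `Q₁`, `Q₂`, `Q₃` -/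

/-- The renormalised bracket `R₂(a | b)_t = a(t) ∫_0^t (b(τ) - M(b)) dτ`. -/
def ren (a b : ℝ → ℂ) (t : ℝ) : ℂ := a t * ∫ τ in (0 : ℝ)..t, (b τ - mean b)

/-- `R₃(a | b | c) = R₂(a | R₂(b | c))`. -/
def ren3 (a b c : ℝ → ℂ) : ℝ → ℂ := ren a (ren b c)

/-- `R₄(a | b | c | d) = R₂(a | R₃(b | c | d))`. -/
def ren4 (a b c d : ℝ → ℂ) : ℝ → ℂ := ren a (ren3 b c d)

/-- `q(t) = exp(i ∫_0^t f)`. -/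
def q (f : ℝ → ℝ) (t : ℝ) : ℂ :=
  Complex.exp (Complex.I * ((∫ τ in (0 : ℝ)..t, f τ : ℝ) : ℂ))

/-- `Q₀ = q²`. -/
def Q0 (f : ℝ → ℝ) (t : ℝ) : ℂ := q f t ^ 2

/-- `Q₁(t) = Q₀(t) ∫_0^t (Q₀⁻¹ - M(Q₀⁻¹))`. -/
def Q1 (f : ℝ → ℝ) : ℝ → ℂ := ren (Q0 f) fun t => (Q0 f t)⁻¹

/-- `Q₂(t) = Q₀(t) ∫_0^t (Q₀ - M(Q₀))`. -/
def Q2 (f : ℝ → ℝ) : ℝ → ℂ := ren (Q0 f) (Q0 f)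

/-- `Q₃(t) = Q₀(t) ∫_0^t (Q₁ - M(Q₁))`. -/
def Q3 (f : ℝ → ℝ) : ℝ → ℂ := ren (Q0 f) (Q1 f)

/-! ### The coefficients of the expansion -/

/-- The functions `v_n`, `n ≥ 1`, with integration constants `κ_n` (`v_0 = 0` by convention). -/
def v (f : ℝ → ℝ) (κ : ℕ → ℂ) : ℕ → ℝ → ℂ
  | 0 => fun _ => 0
  | 1 => fun t => κ 1 * q f t
  | 2 => fun t => q f t *
      (Complex.I * (∫ τ in (0 : ℝ)..t, (κ 1 ^ 2 * Q0 f τ - (Q0 f τ)⁻¹)) + κ 2)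
  | n + 3 => fun t => q f t *
      (Complex.I * (∫ τ in (0 : ℝ)..t,
        ∑ p ∈ (Finset.Ico 1 (n + 3)).attach, v f κ p.1 τ * v f κ (n + 3 - p.1) τ) + κ (n + 3))
termination_by n => n
decreasing_by
  · exact (Finset.mem_Ico.mp p.2).2
  · have := Finset.mem_Ico.mp p.2
    omega

/-- The sum in the recursion, without membership proofs. -/
theorem v_eq (f : ℝ → ℝ) (κ : ℕ → ℂ) (n : ℕ) (hn : 3 ≤ n) (t : ℝ) :
    v f κ n t = q f t * (Complex.I * (∫ τ in (0 : ℝ)..t,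
      ∑ p ∈ Finset.Ico 1 n, v f κ p τ * v f κ (n - p) τ) + κ n) := by
  obtain ⟨k, rfl⟩ := Nat.exists_eq_add_of_le' hn
  rw [v]
  have h : ∀ τ : ℝ, ∑ p ∈ (Finset.Ico 1 (k + 3)).attach, v f κ p.1 τ * v f κ (k + 3 - p.1) τ
      = ∑ p ∈ Finset.Ico 1 (k + 3), v f κ p τ * v f κ (k + 3 - p) τ := fun τ =>
    Finset.sum_attach (Finset.Ico 1 (k + 3)) fun p => v f κ p τ * v f κ (k + 3 - p) τ
  simp only [h]

/-- The coefficient `g_n = q v_n` of `ε^n` in `g = q ∑_{n ≥ 1} v_n ε^n`. -/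
def g (f : ℝ → ℝ) (κ : ℕ → ℂ) (n : ℕ) (t : ℝ) : ℂ := q f t * v f κ n t

/-- `l_m(t) = i q(t)² ∫_0^t ∑_{p=1}^{m-1} v_p v_{m-p}`, which is `q (v_m - κ_m q)` for `m ≥ 3`. -/
def l (f : ℝ → ℝ) (κ : ℕ → ℂ) (m : ℕ) (t : ℝ) : ℂ :=
  Complex.I * q f t ^ 2 * ∫ τ in (0 : ℝ)..t, ∑ p ∈ Finset.Ico 1 m, v f κ p τ * v f κ (m - p) τ

/-- The product `v_p v_r`. -/
def vv (f : ℝ → ℝ) (κ : ℕ → ℂ) (p r : ℕ) (t : ℝ) : ℂ := v f κ p t * v f κ r t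

/-! ### The explicit expressions entering the integration constants -/

/-- `s = -Q₀⁻¹ (κ₁² Q₂ - Q₁)²`. -/
def s (f : ℝ → ℝ) (κ : ℕ → ℂ) (t : ℝ) : ℂ :=
  -(Q0 f t)⁻¹ * (κ 1 ^ 2 * Q2 f t - Q1 f t) ^ 2

/-- The function `𝒜₁`. -/
def A1 (f : ℝ → ℝ) (κ : ℕ → ℂ) (t : ℝ) : ℂ :=
  -4 * κ 1 ^ 4 * ren3 (Q0 f) (Q0 f) (Q2 f) t
    + 4 * κ 1 ^ 2 * ren3 (Q0 f) (Q0 f) (Q1 f) t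
    + ren (Q0 f) (s f κ) t

/-- The function `𝒜₂`. -/
def A2 (f : ℝ → ℝ) (κ : ℕ → ℂ) (t : ℝ) : ℂ :=
  8 * κ 1 ^ 6 * ren3 (Q0 f) (Q2 f) (Q2 f) t
    - 8 * κ 1 ^ 4 * ren3 (Q0 f) (Q2 f) (Q1 f) t
    - 8 * Complex.I * κ 1 ^ 4 * κ 2 * ren3 (Q0 f) (Q2 f) (Q0 f) t
    - 8 * κ 1 ^ 4 * ren3 (Q0 f) (Q1 f) (Q2 f) t
    + 8 * κ 1 ^ 2 * ren3 (Q0 f) (Q1 f) (Q1 f) t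
    + 8 * Complex.I * κ 1 ^ 2 * κ 2 * ren3 (Q0 f) (Q1 f) (Q0 f) t
    + 16 * Complex.I * κ 1 ^ 2 * κ 2 * ren3 (Q0 f) (Q0 f) (Q1 f) t
    - 32 * Complex.I * κ 1 ^ 4 * κ 2 * ren3 (Q0 f) (Q0 f) (Q2 f) t
    - 12 * κ 1 ^ 2 * κ 2 ^ 2 * ren (Q0 f) (Q2 f) t
    - 4 * κ 1 ^ 2 * ren (Q0 f) (A1 f κ) t

/-- The function `𝒜₃`. -/
def A3 (f : ℝ → ℝ) (κ : ℕ → ℂ) (t : ℝ) : ℂ :=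
  8 * κ 1 ^ 6 * ren3 (Q2 f) (Q0 f) (Q2 f) t
    - 8 * κ 1 ^ 4 * ren3 (Q2 f) (Q0 f) (Q1 f) t
    - 8 * Complex.I * κ 1 ^ 4 * κ 2 * ren3 (Q2 f) (Q0 f) (Q0 f) t
    - 8 * κ 1 ^ 4 * ren3 (Q1 f) (Q0 f) (Q2 f) t
    + 8 * κ 1 ^ 2 * ren3 (Q1 f) (Q0 f) (Q1 f) t
    + 8 * Complex.I * κ 1 ^ 2 * κ 2 * ren3 (Q1 f) (Q0 f) (Q0 f) t
    - 8 * Complex.I * κ 1 ^ 4 * κ 2 * ren3 (Q0 f) (Q0 f) (Q2 f) t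
    + 8 * Complex.I * κ 1 ^ 2 * κ 2 * ren3 (Q0 f) (Q0 f) (Q1 f) t
    - 8 * κ 1 ^ 2 * κ 2 ^ 2 * ren3 (Q0 f) (Q0 f) (Q0 f) t
    - 2 * κ 1 ^ 2 * ren (Q2 f) (vv f κ 2 2) t
    + 2 * ren (Q1 f) (vv f κ 2 2) t
    + 2 * Complex.I * κ 2 * ren (Q0 f) (vv f κ 2 2) t

/-- The function `𝒜₄`. -/
def A4 (f : ℝ → ℝ) (κ : ℕ → ℂ) (t : ℝ) : ℂ :=
  (Q0 f t)⁻¹ * (Complex.I * κ 1 ^ 3 * ren (Q0 f) (Q2 f) t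
    - Complex.I * κ 1 * ren (Q0 f) (Q1 f) t + κ 1 * κ 2 * Q2 f t) ^ 2

/-- The number `ℛ⁽¹⁾_n`, `n ≥ 7`. -/
def R1 (f : ℝ → ℝ) (κ : ℕ → ℂ) (n : ℕ) : ℂ :=
  2 * Complex.I * κ 1 * (∑ p ∈ Finset.Icc 1 (n - 4),
      (-2 * κ 1 ^ 2 * mean (ren4 (Q0 f) (Q0 f) (Q0 f) (vv f κ p (n - 3 - p)))
        + mean (ren3 (Q0 f) (Q1 f) (vv f κ p (n - 3 - p)))
        - κ 1 ^ 2 * mean (ren3 (Q0 f) (Q2 f) (vv f κ p (n - 3 - p)))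
        + Complex.I * κ 2 * mean (ren3 (Q0 f) (Q0 f) (vv f κ p (n - 3 - p)))))
    - 2 * κ 1 ^ 2 * (∑ p ∈ Finset.Icc 2 (n - 4),
        mean (ren3 (Q0 f) (Q0 f) (vv f κ p (n - 2 - p))))
    + Complex.I * κ 1 * (∑ p ∈ Finset.Icc 3 (n - 4),
        mean (ren (Q0 f) (vv f κ p (n - 1 - p))))

/-- The number `ℛ⁽²⁾_n`, `n ≥ 7`. -/
def R2 (f : ℝ → ℝ) (κ : ℕ → ℂ) (n : ℕ) : ℂ :=
  -2 * κ 1 * (∑ p ∈ Finset.Icc 1 (n - 4),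
      mean (ren3 (fun t => q f t * v f κ 2 t) (Q0 f) (vv f κ p (n - 3 - p))))
    + Complex.I * (∑ p ∈ Finset.Icc 2 (n - 4),
      mean (ren (fun t => q f t * v f κ 2 t) (vv f κ p (n - 2 - p))))

/-- The explicit recursive choice of the integration constants `κ_n`, `n ≥ 1`; either square root
is allowed for `κ₁`. For `n ≥ 7` the right-hand side in `recursion` only involves
`κ_1, …, κ_{n-4}`. -/
structure IsSecularFreeChoice (f : ℝ → ℝ) (κ : ℕ → ℂ) : Prop where
  kappa1 : κ 1 ^ 2 = (starRingEnd ℂ) (mean (Q3 f)) / mean (Q3 f)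
  kappa2 : κ 2 = -(Complex.I * mean (A1 f κ)) / (2 * mean (Q3 f))
  kappa3 : κ 3 = (4 * mean (A4 f κ) - mean (A3 f κ) - mean (A2 f κ)) / (4 * κ 1 * mean (Q3 f))
  recursion : ∀ n : ℕ, 7 ≤ n → κ (n - 3) = (-1) / (4 * κ 1 * mean (Q3 f)) *
    ((∑ p ∈ Finset.Icc 4 (n - 4), mean (vv f κ p (n - p))) + 2 * R1 f κ n + 2 * R2 f κ n
      + 2 * mean (fun t => (q f t)⁻¹ * v f κ 3 t * l f κ (n - 3) t))

end QPRiccati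

end

/-! Write v_n = q u_n. The Riccati recursion for q v_n = Q₀ u_n follows by differentiation for any
constants κ_n (`hasDerivAt_g`). The constants matter only for quasi-periodicity: u_n is i times a
primitive of Q₀ ∑ u_p u_{n-p}, plus κ_n, and this primitive is again an exponential sum once the
integrand has mean zero and the small divisors are controlled.

Small divisors. With θ = M(f), all functions built from Q₀ and Q₀⁻¹ have frequencies m·ω + 2kθ,
while the hypothesis controls only |k| ≤ 1. Condition (III) closes this gap: Q₃ contains only k = 1
and k = 2, and a nonzero mean requires a zero frequency, so 4θ lies in the lattice of the m·ω
(`exists_resonance`). Then k can be reduced modulo 2 and every divisor is controlled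
(`divisor_of_resonance`). Each integration costs one factor of the weight, which is absorbed by
decay faster than every power (`Rep.prim`).

Vanishing means. Only a linear mean M, a linear primitive I and partial integration are needed, so
the computation is done in an abstract `MeanCalculus` with a = Q₀ and b = Q₀⁻¹. In the mean of order
n ≥ 7, κ_{n-1} and κ_{n-2} drop out because M(a), M(a Ia) and M(a Ib) vanish. The contributions of
κ_{n-3} through u_{n-1} and u_{n-2} cancel by partial integration, leaving 2κ_{n-3} M(a u₃) = 4κ₁μ
κ_{n-3}. As μ ≠ 0, this is a solvable linear equation for κ_{n-3}. Order 3 vanishes by itself, order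
4 demands κ₁²μ = M(b I(b Ia)), which is the conjugate of μ since |Q₀| = 1, and orders 5 and 6 fix κ₂
and κ₃. A single induction (`vq_mem`) yields membership of u_n in the algebra together with the
vanishing means. -/

namespace QPRiccati

/-! ### Mean values -/

/-- The symmetric averages of `h` converge to `z`. -/
def HasMean (h : ℝ → ℂ) (z : ℂ) : Prop :=
  Tendsto (fun T : ℝ => (1 / (2 * (T : ℂ))) * ∫ t in (-T)..T, h t) atTop (𝓝 z)

theorem HasMean.mean_eq {h : ℝ → ℂ} {z : ℂ} (hh : HasMean h z) : mean h = z :=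
  Tendsto.limUnder_eq hh

theorem HasMean.add {h k : ℝ → ℂ} {y z : ℂ} (hh : HasMean h y) (hk : HasMean k z)
    (hc : Continuous h) (kc : Continuous k) : HasMean (fun t => h t + k t) (y + z) := by
  refine (Tendsto.add hh hk).congr fun T => ?_
  rw [intervalIntegral.integral_add (hc.intervalIntegrable _ _) (kc.intervalIntegrable _ _)]
  ring

theorem HasMean.const_mul {h : ℝ → ℂ} {z : ℂ} (hh : HasMean h z) (c : ℂ) :
    HasMean (fun t => c * h t) (c * z) := by
  refine (Tendsto.const_mul c hh).congr fun T => ?_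
  rw [intervalIntegral.integral_const_mul]
  ring

theorem hasMean_const (c : ℂ) : HasMean (fun _ => c) c := by
  refine tendsto_const_nhds.congr' ?_
  filter_upwards [eventually_gt_atTop 0] with T hT
  have : (T : ℂ) ≠ 0 := by exact_mod_cast hT.ne'
  rw [intervalIntegral.integral_const]
  simp only [Complex.real_smul]
  push_cast
  field_simp
  ring

theorem HasMean.conj {h : ℝ → ℂ} {z : ℂ} (hh : HasMean h z) :
    HasMean (fun t => (starRingEnd ℂ) (h t)) ((starRingEnd ℂ) z) := by
  refine ((Complex.continuous_conj.tendsto z).comp hh).congr fun T => ?_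
  have : ∫ t in (-T)..T, (starRingEnd ℂ) (h t) = (starRingEnd ℂ) (∫ t in (-T)..T, h t) := by
    simp only [intervalIntegral, integral_conj, map_sub]
  simp [this, map_ofNat]

/-- The derivative of a bounded function has mean value zero. -/
theorem hasMean_zero_of_hasDerivAt {h b : ℝ → ℂ} {K : ℝ} (hK : ∀ t, ‖h t‖ ≤ K)
    (hd : ∀ t, HasDerivAt h (b t) t) (hb : Continuous b) : HasMean b 0 := by
  have hlim : Tendsto (fun T : ℝ => (1 / (2 * T)) * (K + K)) atTop (𝓝 0) := by
    have : Tendsto (fun T : ℝ => T⁻¹ * K) atTop (𝓝 (0 * K)) :=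
      tendsto_inv_atTop_zero.mul_const K
    rw [zero_mul] at this
    refine this.congr fun T => ?_
    by_cases hT : T = 0
    · simp [hT]
    · field_simp; ring
  refine squeeze_zero_norm' ?_ hlim
  filter_upwards [eventually_gt_atTop 0] with T hT
  rw [intervalIntegral.integral_eq_sub_of_hasDerivAt (fun t _ => hd t) (hb.intervalIntegrable _ _)]
  rw [norm_mul]
  have h1 : ‖(1 / (2 * (T : ℂ)))‖ = 1 / (2 * T) := by
    simp [abs_of_pos hT]
  rw [h1]
  gcongr
  exact (norm_sub_le _ _).trans (add_le_add (hK _) (hK _))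

/-! ### Absolutely convergent exponential sums with weighted coefficients -/

/-- The character `t ↦ exp(i λ t)`. -/
noncomputable def expo (x t : ℝ) : ℂ := Complex.exp (Complex.I * (x : ℂ) * (t : ℂ))

theorem norm_expo (x t : ℝ) : ‖expo x t‖ = 1 := by
  rw [expo, mul_assoc, mul_comm, ← Complex.ofReal_mul, Complex.norm_exp_ofReal_mul_I]

theorem expo_add (x y t : ℝ) : expo (x + y) t = expo x t * expo y t := by
  simp only [expo, ← Complex.exp_add]
  congr 1
  push_cast
  ring

theorem expo_zero (t : ℝ) : expo 0 t = 1 := by simp [expo]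

theorem continuous_expo (x : ℝ) : Continuous (expo x) := by
  unfold expo; fun_prop

theorem hasDerivAt_expo (x t : ℝ) :
    HasDerivAt (expo x) (Complex.I * x * expo x t) t := by
  have h : HasDerivAt (fun t : ℝ => Complex.I * (x : ℂ) * (t : ℂ)) (Complex.I * x * 1) t :=
    (Complex.ofRealCLM.hasDerivAt (x := t)).const_mul _
  have := h.cexp
  rw [mul_one, mul_comm (Complex.exp _)] at this
  exact this

/-- Submultiplicative weights `W ≥ 1`. -/
structure IsWeight {Γ : Type} [AddCommGroup Γ] (W : Γ → ℝ) : Prop where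
  one_le : ∀ γ, 1 ≤ W γ
  submul : ∀ γ δ, W (γ + δ) ≤ W γ * W δ

section Expansion

variable {Γ : Type} [AddCommGroup Γ] {φ : Γ →+ ℝ} {W : Γ → ℝ}

theorem IsWeight.pos (hW : IsWeight W) (γ : Γ) : 0 < W γ := zero_lt_one.trans_le (hW.one_le γ)

/-- `h(t) = ∑ i, c i exp(i φ(γ i) t)` with `γ i ∈ S`, where for every `N` the sum of the
`|c i| W(γ i)^N` is at most `B N`. -/
structure Expansion (φ : Γ →+ ℝ) (W : Γ → ℝ) (S : Set Γ) (B : ℕ → ℝ) (h : ℝ → ℂ) {ι : Type}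
    (c : ι → ℂ) (γ : ι → Γ) : Prop where
  mem : ∀ i, γ i ∈ S
  summable : ∀ N : ℕ, Summable fun i => ‖c i‖ * W (γ i) ^ N
  bound : ∀ N : ℕ, ∑' i, ‖c i‖ * W (γ i) ^ N ≤ B N
  hasSum : ∀ t, HasSum (fun i => c i * expo (φ (γ i)) t) (h t)

/-- Existence of an expansion with bounds `B`. -/
def RepB (φ : Γ →+ ℝ) (W : Γ → ℝ) (S : Set Γ) (B : ℕ → ℝ) (h : ℝ → ℂ) : Prop :=
  ∃ (ι : Type) (_ : Countable ι) (c : ι → ℂ) (γ : ι → Γ), Expansion φ W S B h c γ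

/-- Existence of an expansion with rapidly decaying coefficients and indices in `S`. -/
def Rep (φ : Γ →+ ℝ) (W : Γ → ℝ) (S : Set Γ) (h : ℝ → ℂ) : Prop := ∃ B, RepB φ W S B h

theorem Expansion.summable_norm {S : Set Γ} {B : ℕ → ℝ} {h : ℝ → ℂ} {ι : Type} {c : ι → ℂ}
    {γ : ι → Γ} (he : Expansion φ W S B h c γ) : Summable fun i => ‖c i‖ := by
  simpa using he.summable 0

theorem Rep.of_summable {S : Set Γ} {h : ℝ → ℂ} {ι : Type} [Countable ι] {c : ι → ℂ}
    {γ : ι → Γ} (hS : ∀ i, γ i ∈ S) (hs : ∀ N : ℕ, Summable fun i => ‖c i‖ * W (γ i) ^ N)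
    (hh : ∀ t, HasSum (fun i => c i * expo (φ (γ i)) t) (h t)) : Rep φ W S h :=
  ⟨_, ι, ‹_›, c, γ, hS, hs, fun _ => le_rfl, hh⟩

theorem Rep.mono {S T : Set Γ} {h : ℝ → ℂ} (hh : Rep φ W S h) (hST : S ⊆ T) : Rep φ W T h := by
  obtain ⟨B, ι, hι, c, γ, he⟩ := hh
  exact ⟨B, ι, hι, c, γ, fun i => hST (he.mem i), he.summable, he.bound, he.hasSum⟩

theorem Rep.single (γ : Γ) (c : ℂ) : Rep φ W {γ} fun t => c * expo (φ γ) t :=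
  Rep.of_summable (ι := Unit) (c := fun _ => c) (γ := fun _ => γ) (by simp)
    (fun N => (hasSum_fintype _).summable) fun t => by simp

theorem Rep.const (c : ℂ) : Rep φ W {0} fun _ => c := by
  simpa [expo_zero] using Rep.single (φ := φ) (W := W) 0 c

theorem Rep.add {S T : Set Γ} {h k : ℝ → ℂ} (hh : Rep φ W S h) (hk : Rep φ W T k) :
    Rep φ W (S ∪ T) fun t => h t + k t := by
  obtain ⟨B, ι, hι, c, γ, he⟩ := hh
  obtain ⟨B', κ, hκ, d, δ, he'⟩ := hk
  refine Rep.of_summable (c := Sum.elim c d) (γ := Sum.elim γ δ) ?_ ?_ ?_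
  · rintro (i | i)
    · exact Or.inl (he.mem i)
    · exact Or.inr (he'.mem i)
  · intro N
    exact (HasSum.sum (f := fun i => ‖Sum.elim c d i‖ * W (Sum.elim γ δ i) ^ N)
      (he.summable N).hasSum (he'.summable N).hasSum).summable
  · intro t
    exact HasSum.sum (f := fun i => Sum.elim c d i * expo (φ (Sum.elim γ δ i)) t)
      (he.hasSum t) (he'.hasSum t)

theorem Rep.const_mul {S : Set Γ} {h : ℝ → ℂ} (hh : Rep φ W S h) (a : ℂ) :
    Rep φ W S fun t => a * h t := by
  obtain ⟨B, ι, hι, c, γ, he⟩ := hh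
  refine Rep.of_summable (c := fun i => a * c i) (γ := γ) he.mem ?_ ?_
  · intro N
    refine ((he.summable N).mul_left ‖a‖).congr fun i => ?_
    rw [norm_mul]; ring
  · intro t
    refine ((he.hasSum t).mul_left a).congr_fun ?_
    intro i; ring

-- Pairs of indices index the product; equal frequencies need not be collected. Submultiplicativity
-- of W makes the bounds multiply, which the exponential series needs quantitatively.
open scoped Pointwise in
theorem RepB.mul (hW : IsWeight W) {S T : Set Γ} {B B' : ℕ → ℝ} {h k : ℝ → ℂ}
    (hh : RepB φ W S B h) (hk : RepB φ W T B' k) :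
    RepB φ W (S + T) (fun N => B N * B' N) fun t => h t * k t := by
  obtain ⟨ι, hι, c, γ, he⟩ := hh
  obtain ⟨κ, hκ, d, δ, he'⟩ := hk
  have h0 : ∀ N (i : ι), 0 ≤ ‖c i‖ * W (γ i) ^ N := fun N i =>
    mul_nonneg (norm_nonneg _) (pow_nonneg (hW.pos _).le _)
  have h0' : ∀ N (i : κ), 0 ≤ ‖d i‖ * W (δ i) ^ N := fun N i =>
    mul_nonneg (norm_nonneg _) (pow_nonneg (hW.pos _).le _)
  have hs : ∀ N, Summable fun x : ι × κ =>
      (‖c x.1‖ * W (γ x.1) ^ N) * (‖d x.2‖ * W (δ x.2) ^ N) := fun N =>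
    (he.summable N).mul_of_nonneg (he'.summable N) (h0 N) (h0' N)
  have hle : ∀ N (x : ι × κ), ‖c x.1 * d x.2‖ * W (γ x.1 + δ x.2) ^ N ≤
      (‖c x.1‖ * W (γ x.1) ^ N) * (‖d x.2‖ * W (δ x.2) ^ N) := by
    intro N x
    calc _ ≤ ‖c x.1 * d x.2‖ * (W (γ x.1) * W (δ x.2)) ^ N := by
          gcongr
          · exact (hW.pos _).le
          · exact hW.submul _ _
      _ = _ := by rw [norm_mul, mul_pow]; ring
  have hs' : ∀ N, Summable fun x : ι × κ => ‖c x.1 * d x.2‖ * W (γ x.1 + δ x.2) ^ N := fun N =>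
    Summable.of_nonneg_of_le
      (fun x => mul_nonneg (norm_nonneg _) (pow_nonneg (hW.pos _).le _)) (hle N) (hs N)
  refine ⟨ι × κ, inferInstance, fun x => c x.1 * d x.2, fun x => γ x.1 + δ x.2,
    fun x => Set.add_mem_add (he.mem _) (he'.mem _), hs', ?_, ?_⟩
  · intro N
    calc _ ≤ ∑' x : ι × κ, (‖c x.1‖ * W (γ x.1) ^ N) * (‖d x.2‖ * W (δ x.2) ^ N) :=
          (hs' N).tsum_le_tsum (hle N) (hs N)
      _ = (∑' i, ‖c i‖ * W (γ i) ^ N) * ∑' i, ‖d i‖ * W (δ i) ^ N :=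
          ((he.summable N).tsum_mul_tsum (he'.summable N) (hs N)).symm
      _ ≤ _ := mul_le_mul (he.bound N) (he'.bound N) (tsum_nonneg (h0' N))
          ((tsum_nonneg (h0 N)).trans (he.bound N))
  · intro t
    have hn : Summable fun x : ι × κ =>
        (c x.1 * expo (φ (γ x.1)) t) * (d x.2 * expo (φ (δ x.2)) t) := by
      refine Summable.of_norm ?_
      refine (he.summable_norm.mul_of_nonneg he'.summable_norm (fun _ => norm_nonneg _)
        (fun _ => norm_nonneg _)).congr fun x => ?_
      simp [norm_expo]
    refine ((he.hasSum t).mul (he'.hasSum t) hn).congr_fun fun x => ?_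
    rw [map_add, expo_add]
    ring

open scoped Pointwise in
theorem Rep.mul (hW : IsWeight W) {S T : Set Γ} {h k : ℝ → ℂ} (hh : Rep φ W S h)
    (hk : Rep φ W T k) : Rep φ W (S + T) fun t => h t * k t := by
  obtain ⟨B, hB⟩ := hh
  obtain ⟨B', hB'⟩ := hk
  exact ⟨_, hB.mul hW hB'⟩

/-- Countable sums of expansions with summable bounds. -/
theorem Rep.of_hasSum (hW : IsWeight W) {S : Set Γ} {B : ℕ → ℕ → ℝ} {h : ℕ → ℝ → ℂ} {k : ℝ → ℂ}
    (hh : ∀ j, RepB φ W S (B j) (h j)) (hB : ∀ N, Summable fun j => B j N)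
    (hk : ∀ t, HasSum (fun j => h j t) (k t)) : Rep φ W S k := by
  choose ι hι c γ he using hh
  have hs : ∀ N : ℕ, Summable fun x : Σ j, ι j => ‖c x.1 x.2‖ * W (γ x.1 x.2) ^ N := by
    intro N
    have h0 : ∀ j i, 0 ≤ ‖c j i‖ * W (γ j i) ^ N := fun j i =>
      mul_nonneg (norm_nonneg _) (pow_nonneg (hW.pos _).le _)
    rw [summable_sigma_of_nonneg fun x => h0 x.1 x.2]
    exact ⟨fun j => (he j).summable N, Summable.of_nonneg_of_le
      (fun j => tsum_nonneg (h0 j)) (fun j => (he j).bound N) (hB N)⟩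
  refine Rep.of_summable (ι := Σ j, ι j) (c := fun x => c x.1 x.2) (γ := fun x => γ x.1 x.2)
    (fun x => (he x.1).mem x.2) hs fun t => ?_
  have hn : Summable fun x : Σ j, ι j => c x.1 x.2 * expo (φ (γ x.1 x.2)) t := by
    refine Summable.of_norm ((hs 0).congr fun x => ?_)
    simp [norm_expo]
  have := hn.hasSum.sigma fun j => (he j).hasSum t
  rw [← this.unique (hk t)]
  exact hn.hasSum

/-- The exponential of an expansion with indices in a submonoid. -/
theorem Rep.cexp (hW : IsWeight W) {S : AddSubmonoid Γ} {h : ℝ → ℂ} (hh : Rep φ W S h) :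
    Rep φ W S fun t => Complex.exp (h t) := by
  obtain ⟨B, hB⟩ := hh
  have h1 : ∃ B₁, RepB φ W (S : Set Γ) B₁ fun _ => (1 : ℂ) :=
    (Rep.const (φ := φ) (W := W) 1).mono (by simp)
  obtain ⟨B₁, hB₁⟩ := h1
  -- Explicit bounds are carried along: mere existence of an expansion for each power would not make
  -- the exponential series summable. The factorial is built up by multiplying with h / (j + 1).
  have hpow : ∀ j : ℕ, RepB φ W (S : Set Γ)
      (fun N => B₁ N * (B N ^ j / j.factorial)) fun t => h t ^ j / j.factorial := by
    intro j
    induction j with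
    | zero => simpa using hB₁
    | succ j ih =>
      have h2 : RepB φ W (S : Set Γ) (fun N => B N / ((j : ℝ) + 1)) fun t =>
          h t / ((j : ℂ) + 1) := by
        obtain ⟨ι, hι, c, γ, he⟩ := hB
        have hj : ‖((j : ℂ) + 1)‖ = (j : ℝ) + 1 := by
          have : ((j : ℂ) + 1) = ((j + 1 : ℕ) : ℂ) := by push_cast; ring
          rw [this, Complex.norm_natCast]; push_cast; ring
        refine ⟨ι, hι, fun i => c i / ((j : ℂ) + 1), γ, he.mem, ?_, ?_, ?_⟩
        · intro N
          refine ((he.summable N).div_const ((j : ℝ) + 1)).congr fun i => ?_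
          rw [norm_div, hj]; ring
        · intro N
          calc _ = (∑' i, ‖c i‖ * W (γ i) ^ N) / ((j : ℝ) + 1) := by
                rw [← tsum_div_const]
                refine tsum_congr fun i => ?_
                rw [norm_div, hj]; ring
            _ ≤ _ := by
                gcongr
                exact he.bound N
        · intro t
          refine ((he.hasSum t).div_const ((j : ℂ) + 1)).congr_fun fun i => ?_
          ring
      obtain ⟨ι, hι, c, γ, he⟩ := ih.mul hW h2
      refine ⟨ι, hι, c, γ, fun i => ?_, he.summable, fun N => (he.bound N).trans_eq ?_,
        fun t => ?_⟩
      · obtain ⟨x, hx, y, hy, hxy⟩ := he.mem i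
        rw [← hxy]
        exact S.add_mem hx hy
      · rw [Nat.factorial_succ, pow_succ]
        push_cast
        field_simp
      · convert he.hasSum t using 1
        rw [Nat.factorial_succ, pow_succ]
        push_cast
        field_simp
  refine Rep.of_hasSum hW hpow (fun N => ?_) fun t => ?_
  · exact (Real.summable_pow_div_factorial (B N)).mul_left _
  · rw [Complex.exp_eq_exp_ℂ]
    exact NormedSpace.expSeries_div_hasSum_exp (h t)

end Expansion

/-! ### Means and renormalised primitives of exponential sums. -/

section Primitive

variable {Γ : Type} [AddCommGroup Γ] {φ : Γ →+ ℝ} {W : Γ → ℝ}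

theorem Rep.continuous {S : Set Γ} {h : ℝ → ℂ} (hh : Rep φ W S h) : Continuous h := by
  obtain ⟨B, ι, hι, c, γ, he⟩ := hh
  have : h = fun t => ∑' i, c i * expo (φ (γ i)) t := funext fun t => (he.hasSum t).tsum_eq.symm
  rw [this]
  refine continuous_tsum (fun i => continuous_const.mul (continuous_expo _)) he.summable_norm ?_
  intro i t
  simp [norm_expo]

theorem Rep.bounded {S : Set Γ} {h : ℝ → ℂ} (hh : Rep φ W S h) : ∃ K, ∀ t, ‖h t‖ ≤ K := by
  obtain ⟨B, ι, hι, c, γ, he⟩ := hh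
  refine ⟨∑' i, ‖c i‖, fun t => ?_⟩
  rw [← (he.hasSum t).tsum_eq]
  refine tsum_of_norm_bounded he.summable_norm.hasSum fun i => ?_
  simp [norm_expo]

theorem hasMean_expo (x : ℝ) : HasMean (expo x) (if x = 0 then 1 else 0) := by
  split_ifs with hx
  · subst hx
    have : expo 0 = fun _ => 1 := funext expo_zero
    rw [this]
    exact hasMean_const 1
  · have hx' : (Complex.I * x) ≠ 0 := mul_ne_zero Complex.I_ne_zero (by exact_mod_cast hx)
    refine hasMean_zero_of_hasDerivAt (h := fun t => expo x t / (Complex.I * x))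
      (K := 1 / ‖Complex.I * x‖) (fun t => ?_) (fun t => ?_) (continuous_expo x)
    · rw [norm_div, norm_expo]
    · have := (hasDerivAt_expo x t).div_const (Complex.I * x)
      rwa [mul_div_cancel_left₀ _ hx'] at this

/-- Termwise integration of an exponential sum. -/
theorem Expansion.hasSum_integral {S : Set Γ} {B : ℕ → ℝ} {h : ℝ → ℂ} {ι : Type} [Countable ι]
    {c : ι → ℂ} {γ : ι → Γ} (he : Expansion φ W S B h c γ) (a b : ℝ) :
    HasSum (fun i => c i * ∫ t in a..b, expo (φ (γ i)) t) (∫ t in a..b, h t) := by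
  have := intervalIntegral.hasSum_integral_of_dominated_convergence (μ := MeasureTheory.volume)
    (a := a) (b := b) (F := fun i t => c i * expo (φ (γ i)) t) (f := h) (fun i _ => ‖c i‖)
    (fun i => (continuous_const.mul (continuous_expo _)).aestronglyMeasurable)
    (fun i => Eventually.of_forall fun t _ => by simp [norm_expo])
    (Eventually.of_forall fun t _ => he.summable_norm)
    (by simp)
    (Eventually.of_forall fun t _ => he.hasSum t)
  simpa only [intervalIntegral.integral_const_mul] using this

/-- Averages of characters are bounded by 1, so dominated convergence allows termwise means; only
zero frequencies survive. -/
theorem Expansion.hasMean {S : Set Γ} {B : ℕ → ℝ} {h : ℝ → ℂ} {ι : Type} [Countable ι]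
    {c : ι → ℂ} {γ : ι → Γ} (he : Expansion φ W S B h c γ) :
    HasMean h (∑' i, c i * (if φ (γ i) = 0 then 1 else 0)) := by
  have key : Tendsto (fun T : ℝ => ∑' i, c i * ((1 / (2 * (T : ℂ))) *
      ∫ t in (-T)..T, expo (φ (γ i)) t)) atTop
      (𝓝 (∑' i, c i * (if φ (γ i) = 0 then 1 else 0))) := by
    refine tendsto_tsum_of_dominated_convergence he.summable_norm
      (fun i => Tendsto.const_mul (c i) (hasMean_expo (φ (γ i)))) ?_
    filter_upwards [eventually_gt_atTop 0] with T hT i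
    have h1 : ‖∫ t in (-T)..T, expo (φ (γ i)) t‖ ≤ 1 * |T - -T| :=
      intervalIntegral.norm_integral_le_of_norm_le_const fun t _ => (norm_expo _ _).le
    have h2 : ‖(1 / (2 * (T : ℂ)))‖ = 1 / (2 * T) := by simp [abs_of_pos hT]
    have h3 : |T - -T| = 2 * T := by rw [abs_of_pos] <;> linarith
    rw [norm_mul, norm_mul, h2]
    calc _ ≤ ‖c i‖ * (1 / (2 * T) * (1 * |T - -T|)) := by gcongr
      _ = ‖c i‖ := by rw [h3]; field_simp
  refine key.congr fun T => ?_
  rw [← ((he.hasSum_integral (-T) T).mul_left (1 / (2 * (T : ℂ)))).tsum_eq]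
  exact tsum_congr fun i => by ring

theorem Rep.hasMean {S : Set Γ} {h : ℝ → ℂ} (hh : Rep φ W S h) : HasMean h (mean h) := by
  obtain ⟨B, ι, hι, c, γ, he⟩ := hh
  have := he.hasMean
  rwa [this.mean_eq]

theorem Rep.exists_zero_of_mean_ne_zero {S : Set Γ} {h : ℝ → ℂ} (hh : Rep φ W S h)
    (hm : mean h ≠ 0) : ∃ γ ∈ S, φ γ = 0 := by
  obtain ⟨B, ι, hι, c, γ, he⟩ := hh
  by_contra! hne
  refine hm ?_
  rw [he.hasMean.mean_eq]
  simp [hne _ (he.mem _)]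

/-- The renormalised primitive `t ↦ ∫_0^t (b - M(b))`. -/
noncomputable def prim (b : ℝ → ℂ) (t : ℝ) : ℂ := ∫ τ in (0 : ℝ)..t, (b τ - mean b)

theorem prim_zero (b : ℝ → ℂ) : prim b 0 = 0 := by simp [prim]

theorem hasDerivAt_prim {b : ℝ → ℂ} (hb : Continuous b) (t : ℝ) :
    HasDerivAt (prim b) (b t - mean b) t :=
  (hb.sub continuous_const).integral_hasStrictDerivAt 0 t |>.hasDerivAt

theorem prim_eq_of_hasDerivAt {h b : ℝ → ℂ} (hd : ∀ t, HasDerivAt h (b t - mean b) t)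
    (hb : Continuous b) (h0 : h 0 = 0) : prim b = h := by
  funext t
  rw [prim, intervalIntegral.integral_eq_sub_of_hasDerivAt (fun t _ => hd t)
    ((hb.sub continuous_const).intervalIntegrable _ _), h0, sub_zero]

/-- Renormalised primitives are again exponential sums, provided that the nonzero frequencies are
not too small compared with the weight. -/
theorem Rep.prim (hW : IsWeight W) {S : Set Γ} {h : ℝ → ℂ} (hh : Rep φ W S h)
    (hdiv : ∀ γ ∈ S, φ γ ≠ 0 → 1 / W γ ≤ |φ γ|) : Rep φ W (S ∪ {0}) (prim h) := by
  obtain ⟨B, ι, hι, c, γ, he⟩ := id hh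
  -- Zero-frequency terms make up the mean, which is subtracted, so they contribute nothing.
  set d : ι → ℂ := fun i => if φ (γ i) = 0 then 0 else c i / (Complex.I * φ (γ i)) with hd
  have hle : ∀ i, ‖d i‖ ≤ ‖c i‖ * W (γ i) := by
    intro i
    by_cases hi : φ (γ i) = 0
    · simp only [hd, hi, if_true, norm_zero]
      exact mul_nonneg (norm_nonneg _) (hW.pos _).le
    · simp only [hd, hi, if_false]
      have h1 := hdiv _ (he.mem i) hi
      rw [norm_div, norm_mul, Complex.norm_I, one_mul, Complex.norm_real, Real.norm_eq_abs,
        div_eq_mul_inv]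
      gcongr
      rw [inv_le_comm₀ (abs_pos.2 hi) (hW.pos _), ← one_div]
      exact h1
  -- Dividing by the frequency costs one factor W, so the weight N for d needs N + 1 for c.
  have hs : ∀ N : ℕ, Summable fun i => ‖d i‖ * W (γ i) ^ N := by
    intro N
    refine Summable.of_nonneg_of_le
      (fun i => mul_nonneg (norm_nonneg _) (pow_nonneg (hW.pos _).le _)) (fun i => ?_)
      (he.summable (N + 1))
    calc _ ≤ (‖c i‖ * W (γ i)) * W (γ i) ^ N := by
          gcongr
          · exact pow_nonneg (hW.pos _).le _
          · exact hle i
      _ = _ := by ring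
  have hsd : Summable d := Summable.of_norm (by simpa using hs 0)
  -- The constants - d i come from the lower limit 0 and account for the extra index 0.
  have hsum : ∀ t, HasSum (fun i => d i * expo (φ (γ i)) t - d i) (QPRiccati.prim h t) := by
    intro t
    have hint := he.hasSum_integral 0 t
    have hc : Summable fun i => c i * (if φ (γ i) = 0 then (1 : ℂ) else 0) := by
      refine Summable.of_norm (he.summable_norm.of_nonneg_of_le (fun _ => norm_nonneg _) fun i => ?_)
      split_ifs <;> simp
    have hm : HasSum (fun i => c i * (if φ (γ i) = 0 then (1 : ℂ) else 0)) (mean h) := by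
      rw [he.hasMean.mean_eq]; exact hc.hasSum
    have hp : QPRiccati.prim h t = (∫ τ in (0 : ℝ)..t, h τ) - t * mean h := by
      rw [QPRiccati.prim, intervalIntegral.integral_sub (hh.continuous.intervalIntegrable _ _)
        (continuous_const.intervalIntegrable _ _)]
      simp
    rw [hp]
    refine (hint.sub (hm.mul_left (t : ℂ))).congr_fun fun i => ?_
    by_cases hi : φ (γ i) = 0
    · simp only [hd, hi, if_true]
      have : expo 0 = fun _ => 1 := funext expo_zero
      simp [this]
      ring
    · simp only [hd, hi, if_false]
      have hx' : (Complex.I * (φ (γ i) : ℂ)) ≠ 0 :=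
        mul_ne_zero Complex.I_ne_zero (by exact_mod_cast hi)
      have hF : ∀ t : ℝ, HasDerivAt (fun t => expo (φ (γ i)) t / (Complex.I * (φ (γ i) : ℂ)))
          (expo (φ (γ i)) t) t := fun t => by
        have := (hasDerivAt_expo (φ (γ i)) t).div_const (Complex.I * (φ (γ i) : ℂ))
        rwa [mul_div_cancel_left₀ _ hx'] at this
      rw [intervalIntegral.integral_eq_sub_of_hasDerivAt (fun t _ => hF t)
        ((continuous_expo _).intervalIntegrable _ _)]
      have : expo (φ (γ i)) 0 = 1 := by simp [expo]
      rw [this]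
      field_simp
      ring
  have hR : Rep φ W S fun t => ∑' i, d i * expo (φ (γ i)) t := by
    refine Rep.of_summable he.mem hs fun t => Summable.hasSum ?_
    refine Summable.of_norm (hsd.norm.congr fun i => ?_)
    simp [norm_expo]
  have : QPRiccati.prim h = fun t => (∑' i, d i * expo (φ (γ i)) t) + -∑' i, d i := by
    funext t
    have h1 : Summable fun i => d i * expo (φ (γ i)) t := by
      refine Summable.of_norm (hsd.norm.congr fun i => ?_)
      simp [norm_expo]
    rw [← (hsum t).tsum_eq, h1.tsum_sub hsd, sub_eq_add_neg]
  rw [this]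
  exact hR.add (Rep.const _)

end Primitive

/-! ### Calculus with mean values and renormalised primitives -/

/-- A commutative algebra with a mean value `M` and a primitive `I` (of the mean-free part) which
are related by partial integration. -/
structure MeanCalculus (R : Type) [CommRing R] [Algebra ℂ R] where
  M : R →ₗ[ℂ] ℂ
  I : R →ₗ[ℂ] R
  parts : ∀ x y, M x = 0 → M y = 0 → I (x * I y + I x * y) = I x * I y
  mean_parts : ∀ x y, M x = 0 → M y = 0 → M (x * I y + I x * y) = 0

/-! ### The exponential sums as a mean calculus. -/

section ExpAlgebra

variable {Γ : Type} [AddCommGroup Γ] (φ : Γ →+ ℝ) {W : Γ → ℝ}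

/-- The algebra of the exponential sums with frequencies `φ γ` and rapidly decaying coefficients. -/
def expAlgebra (hW : IsWeight W) : Subalgebra ℂ (ℝ → ℂ) where
  carrier := {h | Rep φ W Set.univ h}
  mul_mem' := fun hh hk => (Rep.mul hW hh hk).mono (Set.subset_univ _)
  add_mem' := fun hh hk => (Rep.add hh hk).mono (Set.subset_univ _)
  algebraMap_mem' := fun c => (Rep.const c).mono (Set.subset_univ _)

variable {φ}

theorem Rep.mean_add {S T : Set Γ} {h k : ℝ → ℂ} (hh : Rep φ W S h) (hk : Rep φ W T k) :
    mean (fun t => h t + k t) = mean h + mean k :=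
  (hh.hasMean.add hk.hasMean hh.continuous hk.continuous).mean_eq

theorem Rep.mean_const_mul {S : Set Γ} {h : ℝ → ℂ} (hh : Rep φ W S h) (c : ℂ) :
    mean (fun t => c * h t) = c * mean h :=
  (hh.hasMean.const_mul c).mean_eq

theorem Rep.prim_add {S T : Set Γ} {h k : ℝ → ℂ} (hh : Rep φ W S h) (hk : Rep φ W T k) (t : ℝ) :
    QPRiccati.prim (fun t => h t + k t) t = QPRiccati.prim h t + QPRiccati.prim k t := by
  rw [QPRiccati.prim, QPRiccati.prim, QPRiccati.prim, hh.mean_add hk,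
    ← intervalIntegral.integral_add]
  · congr 1
    funext t
    ring
  · exact (hh.continuous.sub continuous_const).intervalIntegrable _ _
  · exact (hk.continuous.sub continuous_const).intervalIntegrable _ _

theorem Rep.prim_const_mul {S : Set Γ} {h : ℝ → ℂ} (hh : Rep φ W S h) (c : ℂ) (t : ℝ) :
    QPRiccati.prim (fun t => c * h t) t = c * QPRiccati.prim h t := by
  rw [QPRiccati.prim, QPRiccati.prim, hh.mean_const_mul, ← intervalIntegral.integral_const_mul]
  congr 1
  funext t
  ring

/-- The product of the two primitives is bounded, vanishes at 0 and has the given function as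
derivative. Boundedness makes that derivative mean-free. -/
theorem prim_mul_prim (hW : IsWeight W) (hdiv : ∀ γ, φ γ ≠ 0 → 1 / W γ ≤ |φ γ|) {x y : ℝ → ℂ}
    (hx : Rep φ W Set.univ x) (hy : Rep φ W Set.univ y) (mx : mean x = 0) (my : mean y = 0) :
    mean (x * prim y + prim x * y) = 0 ∧ prim (x * prim y + prim x * y) = prim x * prim y := by
  have px := hx.prim hW fun γ _ => hdiv γ
  have py := hy.prim hW fun γ _ => hdiv γ
  have hd : ∀ t, HasDerivAt (prim x * prim y) ((x * prim y + prim x * y) t) t := by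
    intro t
    have h1 := hasDerivAt_prim hx.continuous t
    have h2 := hasDerivAt_prim hy.continuous t
    rw [mx, sub_zero] at h1
    rw [my, sub_zero] at h2
    exact h1.mul h2
  have hc : Continuous (x * prim y + prim x * y) :=
    (hx.continuous.mul py.continuous).add (px.continuous.mul hy.continuous)
  obtain ⟨K, hK⟩ := (px.mul hW py).bounded
  have hm : mean (x * prim y + prim x * y) = 0 :=
    (hasMean_zero_of_hasDerivAt hK hd hc).mean_eq
  refine ⟨hm, prim_eq_of_hasDerivAt (fun t => ?_) hc ?_⟩
  · rw [hm, sub_zero]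
    exact hd t
  · simp [prim_zero]

variable (φ) in
/-- Mean values and renormalised primitives on the algebra of exponential sums, in the presence of
control of the small divisors. -/
noncomputable def expCalculus (hW : IsWeight W) (hdiv : ∀ γ, φ γ ≠ 0 → 1 / W γ ≤ |φ γ|) :
    MeanCalculus (expAlgebra φ hW) where
  M :=
    { toFun := fun x => mean (x : ℝ → ℂ)
      map_add' := fun x y => Rep.mean_add x.2 y.2
      map_smul' := fun c x => Rep.mean_const_mul x.2 c }
  I :=
    { toFun := fun x => ⟨prim (x : ℝ → ℂ),
        (Rep.prim hW x.2 fun γ _ => hdiv γ).mono (Set.subset_univ _)⟩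
      map_add' := fun x y => Subtype.ext (funext fun t => Rep.prim_add x.2 y.2 t)
      map_smul' := fun c x => Subtype.ext (funext fun t => Rep.prim_const_mul x.2 c t) }
  parts := fun x y hx hy => Subtype.ext (prim_mul_prim hW hdiv x.2 y.2 hx hy).2
  mean_parts := fun x y hx hy => (prim_mul_prim hW hdiv x.2 y.2 hx hy).1

end ExpAlgebra

/-! ### The lattice of frequencies generated by `ω` and twice the mean value of `f` -/

section Lattice

variable {A : ℕ}

theorem freq_add (ω : Fin A → ℝ) (m n : Fin A → ℤ) : freq ω (m + n) = freq ω m + freq ω n := by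
  simp [freq, add_mul, Finset.sum_add_distrib]

theorem freq_zero (ω : Fin A → ℝ) : freq ω 0 = 0 := by simp [freq]

theorem freq_neg (ω : Fin A → ℝ) (m : Fin A → ℤ) : freq ω (-m) = -freq ω m := by
  simp [freq]

theorem freq_zsmul (ω : Fin A → ℝ) (k : ℤ) (m : Fin A → ℤ) :
    freq ω (k • m) = k * freq ω m := by
  simp [freq, Finset.mul_sum, mul_assoc]

/-- The frequency `m · ω + 2 k θ`. -/
def freqExt (ω : Fin A → ℝ) (θ : ℝ) : (Fin A → ℤ) × ℤ →+ ℝ where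
  toFun γ := freq ω γ.1 + γ.2 * (2 * θ)
  map_zero' := by simp [freq_zero]
  map_add' γ δ := by
    simp only [Prod.fst_add, Prod.snd_add, freq_add]
    push_cast
    ring

theorem freqExt_apply (ω : Fin A → ℝ) (θ : ℝ) (m : Fin A → ℤ) (k : ℤ) :
    freqExt ω θ (m, k) = freq ω m + k * (2 * θ) := rfl

/-- The weight `w(m) c^{|k|}`. -/
def weightExt (w : (Fin A → ℤ) → ℝ) (c : ℝ) (γ : (Fin A → ℤ) × ℤ) : ℝ :=
  w γ.1 * c ^ γ.2.natAbs

theorem isWeight_weightExt {w : (Fin A → ℤ) → ℝ} {c : ℝ} (hw : IsWeight w) (hc : 1 ≤ c) :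
    IsWeight (weightExt w c) where
  one_le γ := one_le_mul_of_one_le_of_one_le (hw.one_le _) (one_le_pow₀ hc)
  submul γ δ := by
    have h1 : c ^ (γ.2 + δ.2).natAbs ≤ c ^ γ.2.natAbs * c ^ δ.2.natAbs := by
      rw [← pow_add]
      exact pow_le_pow_right₀ hc (Int.natAbs_add_le _ _)
    calc weightExt w c (γ + δ) ≤ (w γ.1 * w δ.1) * (c ^ γ.2.natAbs * c ^ δ.2.natAbs) :=
          mul_le_mul (hw.submul _ _) h1 (by positivity)
            (mul_nonneg (hw.pos _).le (hw.pos _).le)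
      _ = _ := by simp only [weightExt]; ring

theorem SmallDivisorControl.isWeight {f : ℝ → ℝ} {ω : Fin A → ℝ} {F : (Fin A → ℤ) → ℂ}
    {w : (Fin A → ℤ) → ℝ} (hw : SmallDivisorControl f ω F w) : IsWeight w :=
  ⟨hw.one_le, hw.submul⟩

theorem SmallDivisorControl.weight_add_zsmul_le {f : ℝ → ℝ} {ω : Fin A → ℝ}
    {F : (Fin A → ℤ) → ℂ} {w : (Fin A → ℤ) → ℝ} (hw : SmallDivisorControl f ω F w)
    (m n : Fin A → ℤ) (j : ℤ) : w (m + j • n) ≤ w m * w n ^ j.natAbs := by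
  have hnat : ∀ (n : Fin A → ℤ) (i : ℕ), w (m + i • n) ≤ w m * w n ^ i := by
    intro n i
    induction i with
    | zero => simp
    | succ i ih =>
      have h0 : 0 ≤ w n := (hw.isWeight.pos n).le
      calc w (m + (i + 1) • n) = w ((m + i • n) + n) := by rw [succ_nsmul, add_assoc]
        _ ≤ w (m + i • n) * w n := hw.submul _ _
        _ ≤ (w m * w n ^ i) * w n := by gcongr
        _ = _ := by ring
  obtain ⟨i, rfl | rfl⟩ := j.eq_nat_or_neg
  · simpa using hnat n i
  · have := hnat (-n) i
    rw [hw.even] at this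
    simpa using this

variable {f : ℝ → ℝ} {ω : Fin A → ℝ} {F : (Fin A → ℤ) → ℂ} {w : (Fin A → ℤ) → ℝ}

theorem rep_of_control (hf : HasFourierExpansion (fun t => (f t : ℂ)) ω F)
    (hw : SmallDivisorControl f ω F w) (θ c : ℝ) :
    Rep (freqExt ω θ) (weightExt w c) {γ | γ.2 = 0} fun t => (f t : ℂ) := by
  refine Rep.of_summable (c := F) (γ := fun m => (m, 0)) (fun _ => rfl) ?_ ?_
  · simpa [weightExt] using hw.decay
  · intro t
    simpa [freqExt_apply, expo] using hf.hasSum t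

/-- Conjugation fixes f, hence its mean; this makes the frequencies m·ω + 2kθ real. -/
theorem mean_ofReal (hf : HasFourierExpansion (fun t => (f t : ℂ)) ω F)
    (hw : SmallDivisorControl f ω F w) :
    mean (fun t => (f t : ℂ)) = ((mean fun t => (f t : ℂ)).re : ℂ) := by
  have h1 := (rep_of_control hf hw 0 1).hasMean
  have h2 := h1.conj
  simp only [Complex.conj_ofReal] at h2
  exact (Complex.conj_eq_iff_re.1 h2.mean_eq.symm).symm

/-- Divisors for the characters with at most one factor `Q₀` or `Q₀⁻¹`. -/
theorem divisor_of_natAbs_le_one (hf : HasFourierExpansion (fun t => (f t : ℂ)) ω F)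
    (hw : SmallDivisorControl f ω F w) {c : ℝ} (hc : 1 ≤ c) {γ : (Fin A → ℤ) × ℤ}
    (hγ : γ.2.natAbs ≤ 1) (h0 : freqExt ω (mean fun t => (f t : ℂ)).re γ ≠ 0) :
    1 / weightExt w c γ ≤ |freqExt ω (mean fun t => (f t : ℂ)).re γ| := by
  obtain ⟨m, k⟩ := γ
  have hcontrol : ∀ n : Fin A → ℤ, freq ω n + 2 * (mean fun t => (f t : ℂ)).re ≠ 0 →
      1 / w n ≤ |freq ω n + 2 * (mean fun t => (f t : ℂ)).re| := by
    intro n hn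
    have := hw.divisor_mean n
    rw [mean_ofReal hf hw] at this
    rw [← Complex.ofReal_ofNat, ← Complex.ofReal_mul, ← Complex.ofReal_add, Complex.norm_real,
      Real.norm_eq_abs] at this
    exact this (by exact_mod_cast hn)
  have hle : 1 / weightExt w c (m, k) ≤ 1 / w m :=
    one_div_le_one_div_of_le (hw.isWeight.pos m)
      (le_mul_of_one_le_right (hw.isWeight.pos m).le (one_le_pow₀ hc))
  refine hle.trans ?_
  rw [freqExt_apply] at h0 ⊢
  have hk : k = 0 ∨ k = 1 ∨ k = -1 := by
    simp only at hγ
    omega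
  rcases hk with rfl | rfl | rfl
  · simp only [Int.cast_zero, zero_mul, add_zero] at h0 ⊢
    exact hw.divisor m h0
  · simp only [Int.cast_one, one_mul] at h0 ⊢
    exact hcontrol m h0
  -- For k = -1, a change of sign leads to k = 1 at -m, and the weight is even.
  · have h2 := hcontrol (-m)
    rw [hw.even, freq_neg] at h2
    have h3 : freq ω m + ((-1 : ℤ) : ℝ) * (2 * (mean fun t => (f t : ℂ)).re) =
        -(-freq ω m + 2 * (mean fun t => (f t : ℂ)).re) := by
      push_cast; ring
    rw [h3] at h0 ⊢
    rw [abs_neg]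
    exact h2 (neg_ne_zero.1 h0)

/-- If `4 M(f) = n · ω`, then all divisors are controlled. -/
theorem divisor_of_resonance (hf : HasFourierExpansion (fun t => (f t : ℂ)) ω F)
    (hw : SmallDivisorControl f ω F w) {n : Fin A → ℤ}
    (hn : freq ω n = 4 * (mean fun t => (f t : ℂ)).re) (γ : (Fin A → ℤ) × ℤ)
    (h0 : freqExt ω (mean fun t => (f t : ℂ)).re γ ≠ 0) :
    1 / weightExt w (w n) γ ≤ |freqExt ω (mean fun t => (f t : ℂ)).re γ| := by
  obtain ⟨m, k⟩ := γ
  -- Since 4θ = n·ω, the even part of 2kθ is moved into the lattice, leaving the remainder k % 2,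
  -- which is 0 or 1.
  have h1 : freqExt ω (mean fun t => (f t : ℂ)).re (m, k) =
      freqExt ω (mean fun t => (f t : ℂ)).re (m + (k / 2) • n, k % 2) := by
    have hk : (k : ℝ) = 2 * ((k / 2 : ℤ) : ℝ) + ((k % 2 : ℤ) : ℝ) := by
      exact_mod_cast (Int.mul_ediv_add_emod k 2).symm
    rw [freqExt_apply, freqExt_apply, freq_add, freq_zsmul, hn, hk]
    ring
  rw [h1] at h0 ⊢
  refine le_trans ?_ (divisor_of_natAbs_le_one hf hw le_rfl (by simp only; omega) h0)
  refine one_div_le_one_div_of_le ((isWeight_weightExt hw.isWeight le_rfl).pos _) ?_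
  simp only [weightExt, one_pow, mul_one]
  -- The shift costs w(n)^{|k/2|} ≤ w(n)^{|k|}, whence the constant c = w(n) in the extended weight.
  refine (hw.weight_add_zsmul_le m n _).trans ?_
  gcongr
  · exact (hw.isWeight.pos m).le
  · exact hw.one_le n
  · omega

/-! ### The functions `q` and `Q₀` -/

theorem continuous_of_control (hf : HasFourierExpansion (fun t => (f t : ℂ)) ω F)
    (hw : SmallDivisorControl f ω F w) : Continuous f := by
  have := (rep_of_control hf hw 0 1).continuous
  exact Complex.continuous_re.comp this

/-- Splits the linear growth θt off ∫f. The factor exp(iθt) corresponds to k = 1/2, so the algebra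
is built on Q₀ rather than q. -/
theorem q_eq (hf : HasFourierExpansion (fun t => (f t : ℂ)) ω F)
    (hw : SmallDivisorControl f ω F w) (t : ℝ) :
    q f t = Complex.exp (Complex.I * prim (fun t => (f t : ℂ)) t) *
      expo (mean fun t => (f t : ℂ)).re t := by
  have hc := continuous_of_control hf hw
  have h1 : prim (fun t => (f t : ℂ)) t = ((∫ τ in (0 : ℝ)..t, f τ : ℝ) : ℂ) -
      t * ((mean fun t => (f t : ℂ)).re : ℂ) := by
    rw [prim, intervalIntegral.integral_sub
      ((show Continuous fun t => (f t : ℂ) from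
        Complex.continuous_ofReal.comp hc).intervalIntegrable _ _)
      (continuous_const.intervalIntegrable _ _), ← mean_ofReal hf hw,
      intervalIntegral.integral_ofReal]
    simp
  rw [q, expo, ← Complex.exp_add, h1]
  congr 1
  ring

theorem q_ne_zero (f : ℝ → ℝ) (t : ℝ) : q f t ≠ 0 := Complex.exp_ne_zero _

theorem rep_exp_prim (hf : HasFourierExpansion (fun t => (f t : ℂ)) ω F)
    (hw : SmallDivisorControl f ω F w) {c : ℝ} (hc : 1 ≤ c) (a : ℂ) :
    Rep (freqExt ω (mean fun t => (f t : ℂ)).re) (weightExt w c) {γ | γ.2 = 0}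
      fun t => Complex.exp (a * prim (fun t => (f t : ℂ)) t) := by
  have hW := isWeight_weightExt hw.isWeight hc
  let S : AddSubmonoid ((Fin A → ℤ) × ℤ) :=
    { carrier := {γ | γ.2 = 0}
      zero_mem' := rfl
      add_mem' := fun {γ δ} h1 h2 => by
        simp only [Set.mem_ofPred_eq] at h1 h2 ⊢
        simp [h1, h2] }
  refine Rep.cexp hW (S := S) (Rep.const_mul ?_ a)
  refine ((rep_of_control hf hw _ c).prim hW fun γ hγ h0 =>
    divisor_of_natAbs_le_one hf hw hc (by simp_all) h0).mono ?_
  rintro γ (h | h)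
  · exact h
  · rw [Set.mem_singleton_iff.1 h]; exact S.zero_mem

theorem rep_Q0 (hf : HasFourierExpansion (fun t => (f t : ℂ)) ω F)
    (hw : SmallDivisorControl f ω F w) {c : ℝ} (hc : 1 ≤ c) :
    Rep (freqExt ω (mean fun t => (f t : ℂ)).re) (weightExt w c) {γ | γ.2 = 1} (Q0 f) := by
  have hW := isWeight_weightExt hw.isWeight hc
  have h1 := (rep_exp_prim hf hw hc (2 * Complex.I)).mul hW (Rep.single (0, 1) 1)
  have h2 : Q0 f = fun t => Complex.exp (2 * Complex.I * prim (fun t => (f t : ℂ)) t) *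
      (1 * expo (freqExt ω (mean fun t => (f t : ℂ)).re (0, 1)) t) := by
    funext t
    rw [Q0, q_eq hf hw, mul_pow, ← Complex.exp_nat_mul, freqExt_apply, freq_zero, zero_add,
      Int.cast_one, one_mul, one_mul, two_mul (mean _).re, expo_add, sq]
    congr 2
    push_cast
    ring
  rw [h2]
  refine h1.mono ?_
  rintro γ ⟨x, hx, y, hy, rfl⟩
  simp only [Set.mem_ofPred_eq, Set.mem_singleton_iff] at hx hy ⊢
  simp [hx, hy]

theorem rep_Q0_inv (hf : HasFourierExpansion (fun t => (f t : ℂ)) ω F)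
    (hw : SmallDivisorControl f ω F w) {c : ℝ} (hc : 1 ≤ c) :
    Rep (freqExt ω (mean fun t => (f t : ℂ)).re) (weightExt w c) {γ | γ.2 = -1}
      fun t => (Q0 f t)⁻¹ := by
  have hW := isWeight_weightExt hw.isWeight hc
  have h1 := (rep_exp_prim hf hw hc (-(2 * Complex.I))).mul hW (Rep.single (0, -1) 1)
  have h2 : (fun t => (Q0 f t)⁻¹) = fun t =>
      Complex.exp (-(2 * Complex.I) * prim (fun t => (f t : ℂ)) t) *
      (1 * expo (freqExt ω (mean fun t => (f t : ℂ)).re (0, -1)) t) := by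
    funext t
    rw [Q0, q_eq hf hw, mul_pow, ← Complex.exp_nat_mul, expo, ← Complex.exp_nat_mul,
      ← Complex.exp_add, ← Complex.exp_neg, freqExt_apply, freq_zero, zero_add, expo, one_mul,
      ← Complex.exp_add]
    congr 1
    push_cast
    ring
  rw [h2]
  refine h1.mono ?_
  rintro γ ⟨x, hx, y, hy, rfl⟩
  simp only [Set.mem_ofPred_eq, Set.mem_singleton_iff] at hx hy ⊢
  simp [hx, hy]

/-- A nonzero mean value of `Q₃` forces a resonance between `4 M(f)` and `ω`. -/
theorem exists_resonance (hf : HasFourierExpansion (fun t => (f t : ℂ)) ω F)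
    (hw : SmallDivisorControl f ω F w) (h3 : mean (Q3 f) ≠ 0) :
    ∃ n : Fin A → ℤ, freq ω n = 4 * (mean fun t => (f t : ℂ)).re := by
  have hW := isWeight_weightExt hw.isWeight (le_refl (1 : ℝ))
  have ha := rep_Q0 hf hw (le_refl (1 : ℝ))
  have hb := rep_Q0_inv hf hw (le_refl (1 : ℝ))
  -- No resonance is available yet, but only divisors with |k| ≤ 1 occur: k = -1 for Q₀⁻¹ and k = 0,
  -- 1 for Q₁.
  have hB := hb.prim hW fun γ hγ h0 =>
    divisor_of_natAbs_le_one hf hw le_rfl (by simp_all) h0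
  have hQ1 : Rep (freqExt ω (mean fun t => (f t : ℂ)).re) (weightExt w 1)
      {γ | γ.2 = 0 ∨ γ.2 = 1} (Q1 f) := by
    refine (ha.mul hW hB).mono ?_
    rintro γ ⟨x, hx, y, hy, rfl⟩
    simp only [Set.mem_ofPred_eq, Set.mem_union, Set.mem_singleton_iff] at hx hy ⊢
    rcases hy with hy | rfl <;> simp [*]
  have hC := hQ1.prim hW fun γ hγ h0 =>
    divisor_of_natAbs_le_one hf hw le_rfl (by rcases hγ with h | h <;> simp [h]) h0
  obtain ⟨γ, hγ, h0⟩ := (ha.mul hW hC).exists_zero_of_mean_ne_zero h3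
  have hγ2 : γ.2 = 1 ∨ γ.2 = 2 := by
    obtain ⟨x, hx, y, hy, rfl⟩ := hγ
    simp only [Set.mem_ofPred_eq, Set.mem_union, Set.mem_singleton_iff] at hx hy
    rcases hy with (hy | hy) | rfl <;> simp [*]
  obtain ⟨m, k⟩ := γ
  rw [freqExt_apply] at h0
  -- m·ω + 2θ = 0 gives n = -2m, and m·ω + 4θ = 0 gives n = -m.
  rcases hγ2 with h | h
  · simp only at h
    subst h
    refine ⟨(-2 : ℤ) • m, ?_⟩
    rw [freq_zsmul]
    push_cast at h0 ⊢
    linarith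
  · simp only at h
    subst h
    refine ⟨(-1 : ℤ) • m, ?_⟩
    rw [freq_zsmul]
    push_cast at h0 ⊢
    linarith

end Lattice

/-! ### The mean values of the coefficients of `g²` -/

namespace MeanCalculus

variable {R : Type} [CommRing R] [Algebra ℂ R] (K : MeanCalculus R) {a b : R}

theorem M_self (ha : K.M a = 0) : K.M (a * K.I a) = 0 := by
  have h := K.mean_parts a a ha ha
  rw [mul_comm (K.I a), ← two_smul ℂ, map_smul, smul_eq_mul] at h
  simpa using h

theorem I_self (ha : K.M a = 0) : K.I a * K.I a = (2 : ℂ) • K.I (a * K.I a) := by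
  rw [← K.parts a a ha ha, mul_comm (K.I a), ← two_smul ℂ, map_smul]

theorem I_sq (ha : K.M a = 0) : K.I (a * K.I a) = (1 / 2 : ℂ) • (K.I a * K.I a) := by
  rw [K.I_self ha, smul_smul]
  norm_num

/-- `M(x ∫y) = -M(y ∫x)`. -/
theorem M_swap {x y : R} (hx : K.M x = 0) (hy : K.M y = 0) :
    K.M (x * K.I y) = -K.M (y * K.I x) := by
  have h := K.mean_parts x y hx hy
  rw [map_add, mul_comm (K.I x)] at h
  linear_combination h

/-- Swapping a Ia with a shows that this mean equals minus half of itself. -/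
theorem M_sq_self (ha : K.M a = 0) : K.M (a * (K.I a * K.I a)) = 0 := by
  have h := K.M_swap (K.M_self ha) ha
  rw [K.I_sq ha, mul_smul_comm, map_smul, mul_assoc, smul_eq_mul] at h
  linear_combination (2 / 3) * h

theorem M_I_self (ha : K.M a = 0) : K.M (a * K.I (a * K.I a)) = 0 := by
  rw [K.I_sq ha, mul_smul_comm, map_smul, K.M_sq_self ha, smul_zero]

theorem M_triple (ha : K.M a = 0) (h1 : K.M (a * K.I b) = 0) :
    K.M (a * (K.I a * K.I b)) = -K.M (a * K.I (a * K.I b)) := by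
  have h := K.M_swap h1 ha
  rw [mul_assoc, mul_comm (K.I b)] at h
  linear_combination h

/-- (Ib)² is twice the primitive of b Ib, and two swaps move the bracket onto b. This brings the
conjugate of μ into order 4. -/
theorem M_sq_right (ha : K.M a = 0) (hb : K.M b = 0) (h1 : K.M (a * K.I b) = 0) :
    K.M (a * (K.I b * K.I b)) = 2 * K.M (b * K.I (b * K.I a)) := by
  have h2 : K.M (b * K.I a) = 0 := by rw [K.M_swap hb ha, h1, neg_zero]
  have h3 := K.M_triple hb h2
  have h4 := K.M_swap (K.M_self hb) ha
  rw [K.I_sq hb, mul_smul_comm, map_smul, mul_assoc, smul_eq_mul] at h4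
  linear_combination 2 * h4 - 2 * h3

/-- The part `∑_{p=j}^{m-j} u_p u_{m-p}` of the Cauchy product. -/
def cauchy (u : ℕ → R) (j m : ℕ) : R := ∑ p ∈ Finset.Ico j (m + 1 - j), u p * u (m - p)

/-- The extreme terms p = j and p = m - j agree by symmetry and are distinct since 2j < m. -/
theorem cauchy_succ (u : ℕ → R) {j m : ℕ} (h : 2 * j < m) :
    cauchy u j m = (2 : ℂ) • (u j * u (m - j)) + cauchy u (j + 1) m := by
  rw [cauchy, Finset.sum_eq_sum_Ico_succ_bot (by omega),
    show m + 1 - j = (m - j) + 1 by omega, Finset.sum_Ico_succ_top (by omega), cauchy,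
    show m - (m - j) = j by omega, show m + 1 - (j + 1) = m - j by omega, two_smul,
    mul_comm (u (m - j))]
  abel

omit [Algebra ℂ R] in
theorem cauchy_self (u : ℕ → R) (j : ℕ) : cauchy u j (2 * j) = u j * u j := by
  rw [cauchy, show 2 * j + 1 - j = j + 1 by omega, Nat.Ico_succ_singleton, Finset.sum_singleton,
    show 2 * j - j = j by omega]

omit [Algebra ℂ R] in
theorem cauchy_eq_zero (u : ℕ → R) {j m : ℕ} (h : m < 2 * j) : cauchy u j m = 0 := by
  rw [cauchy, Finset.Ico_eq_empty (by omega), Finset.sum_empty]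

/-- The data of the recursion `u_m = i ∫ a ∑ u_p u_{m-p} + κ_m`, for `m < n`. -/
structure Recursion (a b : R) (k : ℕ → ℂ) (u : ℕ → R) (n : ℕ) : Prop where
  mul_eq_one : a * b = 1
  mean_a : K.M a = 0
  mean_b : K.M b = 0
  mean_Q1 : K.M (a * K.I b) = 0
  one : u 1 = k 1 • (1 : R)
  two : 2 < n → u 2 = (Complex.I * k 1 ^ 2) • K.I a - Complex.I • K.I b + k 2 • (1 : R)
  step : ∀ m, 3 ≤ m → m < n → u m = Complex.I • K.I (a * cauchy u 1 m) + k m • (1 : R)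

variable {K} {k : ℕ → ℂ} {u : ℕ → R} {n : ℕ}

namespace Recursion

variable (h : K.Recursion a b k u n)
include h

/-- This removes the direct contribution of κ_{n-2} to the mean of order n. -/
theorem mean_a_u2 (hn : 2 < n) : K.M (a * u 2) = 0 := by
  simp only [h.two hn, mul_add, mul_sub, mul_smul_comm, mul_one, map_add, map_sub, map_smul,
    h.mean_a, h.mean_Q1, K.M_self h.mean_a, smul_zero, add_zero, sub_zero]

theorem mean_I_u2 (hn : 2 < n) :
    K.M (a * K.I (a * u 2)) = -Complex.I * K.M (a * K.I (a * K.I b)) := by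
  simp only [h.two hn, mul_add, mul_sub, mul_smul_comm, mul_one, map_add, map_sub, map_smul,
    K.M_self h.mean_a, K.M_I_self h.mean_a, smul_eq_mul]
  ring

theorem three (hn : 3 < n) : u 3 = (2 * Complex.I * k 1) • K.I (a * u 2) + k 3 • (1 : R) := by
  rw [h.step 3 le_rfl hn, cauchy_succ u (by norm_num), cauchy_eq_zero u (by norm_num), h.one]
  simp only [mul_smul_comm, smul_mul_assoc, one_mul, map_smul, smul_smul, add_zero]
  congr 2
  ring

theorem four (hn : 4 < n) :
    u 4 = Complex.I • K.I ((2 * k 1) • (a * u 3) + a * (u 2 * u 2)) + k 4 • (1 : R) := by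
  rw [h.step 4 (by norm_num) hn, cauchy_succ u (by norm_num), cauchy_self u 2, h.one]
  simp only [mul_smul_comm, smul_mul_assoc, one_mul, smul_smul, mul_add]

/-- The source of the nonzero factor 4κ₁μ: κ_{n-3} multiplies twice this mean. -/
theorem mean_a_u3 (hn : 3 < n) :
    K.M (a * u 3) = 2 * k 1 * K.M (a * K.I (a * K.I b)) := by
  rw [h.three hn, mul_add, mul_smul_comm, mul_smul_comm, map_add, map_smul, map_smul, mul_one,
    h.mean_I_u2 (by omega), h.mean_a, smul_eq_mul, smul_zero]
  linear_combination (-2 * k 1 * K.M (a * K.I (a * K.I b))) * Complex.I_sq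

theorem mean_three (hn : n = 3) : K.M (a * cauchy u 1 n) = 0 := by
  subst hn
  rw [cauchy_succ u (by norm_num), cauchy_eq_zero u (by norm_num), h.one]
  simp only [mul_smul_comm, smul_mul_assoc, one_mul, map_smul, add_zero, h.mean_a_u2 (by norm_num),
    smul_zero]

/-- 2κ₁M(a u₃) = 4κ₁²μ, while M(a u₂²) = -2κ₁²μ - 2M(b I(b Ia)); κ₂ drops out, so only κ₁² is
constrained. -/
theorem mean_four (hn : n = 4)
    (hk : k 1 ^ 2 * K.M (a * K.I (a * K.I b)) = K.M (b * K.I (b * K.I a))) :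
    K.M (a * cauchy u 1 n) = 0 := by
  subst hn
  have h2 := K.M_triple h.mean_a h.mean_Q1
  have h2' : K.M (a * (K.I b * K.I a)) = -K.M (a * K.I (a * K.I b)) := by
    rw [mul_comm (K.I b)]; exact h2
  have h3 := K.M_sq_right h.mean_a h.mean_b h.mean_Q1
  rw [cauchy_succ u (by norm_num), cauchy_self u 2, h.one]
  simp only [mul_smul_comm, smul_mul_assoc, one_mul, map_smul, smul_eq_mul, mul_add, map_add,
    h.mean_a_u3 (by norm_num)]
  simp only [h.two (by norm_num), mul_smul_comm, smul_mul_assoc, one_mul, mul_one, map_smul,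
    smul_eq_mul, mul_add, map_add, add_mul, mul_sub, sub_mul, map_sub, h.mean_a, h.mean_Q1, h2,
    h2', h3, K.M_self h.mean_a, K.M_sq_self h.mean_a]
  linear_combination (2 * K.M (b * K.I (b * K.I a)) + 2 * k 1 ^ 2 * K.M (a * K.I (a * K.I b))) *
    Complex.I_sq + 2 * hk

end Recursion

variable (K) in
/-- The abstract form of `𝒜₁`. -/
def calA1 (a b : R) (k : ℕ → ℂ) : R :=
  (-4 * k 1 ^ 4) • (a * K.I (a * K.I (a * K.I a)))
    + (4 * k 1 ^ 2) • (a * K.I (a * K.I (a * K.I b)))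
    + a * K.I (-b * (k 1 ^ 2 • (a * K.I a) - a * K.I b) ^ 2)

variable (K) in
/-- The abstract form of `𝒜₂`. -/
def calA2 (a b : R) (k : ℕ → ℂ) : R :=
  (8 * k 1 ^ 6) • (a * K.I (a * K.I a * K.I (a * K.I a)))
    - (8 * k 1 ^ 4) • (a * K.I (a * K.I a * K.I (a * K.I b)))
    - (8 * Complex.I * k 1 ^ 4 * k 2) • (a * K.I (a * K.I a * K.I a))
    - (8 * k 1 ^ 4) • (a * K.I (a * K.I b * K.I (a * K.I a)))
    + (8 * k 1 ^ 2) • (a * K.I (a * K.I b * K.I (a * K.I b)))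
    + (8 * Complex.I * k 1 ^ 2 * k 2) • (a * K.I (a * K.I b * K.I a))
    + (16 * Complex.I * k 1 ^ 2 * k 2) • (a * K.I (a * K.I (a * K.I b)))
    - (32 * Complex.I * k 1 ^ 4 * k 2) • (a * K.I (a * K.I (a * K.I a)))
    - (12 * k 1 ^ 2 * k 2 ^ 2) • (a * K.I (a * K.I a))
    - (4 * k 1 ^ 2) • (a * K.I (K.calA1 a b k))

variable (K) in
/-- The abstract form of `𝒜₃`, where `x` stands for `v₂²`. -/
def calA3 (a b : R) (k : ℕ → ℂ) (x : R) : R :=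
  (8 * k 1 ^ 6) • (a * K.I a * K.I (a * K.I (a * K.I a)))
    - (8 * k 1 ^ 4) • (a * K.I a * K.I (a * K.I (a * K.I b)))
    - (8 * Complex.I * k 1 ^ 4 * k 2) • (a * K.I a * K.I (a * K.I a))
    - (8 * k 1 ^ 4) • (a * K.I b * K.I (a * K.I (a * K.I a)))
    + (8 * k 1 ^ 2) • (a * K.I b * K.I (a * K.I (a * K.I b)))
    + (8 * Complex.I * k 1 ^ 2 * k 2) • (a * K.I b * K.I (a * K.I a))
    - (8 * Complex.I * k 1 ^ 4 * k 2) • (a * K.I (a * K.I (a * K.I a)))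
    + (8 * Complex.I * k 1 ^ 2 * k 2) • (a * K.I (a * K.I (a * K.I b)))
    - (8 * k 1 ^ 2 * k 2 ^ 2) • (a * K.I (a * K.I a))
    - (2 * k 1 ^ 2) • (a * K.I a * K.I x)
    + (2 : ℂ) • (a * K.I b * K.I x)
    + (2 * Complex.I * k 2) • (a * K.I x)

variable (K) in
/-- The abstract form of `𝒜₄`. -/
def calA4 (a b : R) (k : ℕ → ℂ) : R :=
  b * ((Complex.I * k 1 ^ 3) • (a * K.I (a * K.I a)) - (Complex.I * k 1) • (a * K.I (a * K.I b))
    + (k 1 * k 2) • (a * K.I a)) ^ 2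

variable (K) in
/-- The abstract form of `ℛ⁽¹⁾`, where `x`, `y`, `z` stand for `∑ v_p v_{n-3-p}`,
`∑ v_p v_{n-2-p}`, `∑ v_p v_{n-1-p}`. -/
noncomputable def calR1 (a b : R) (k : ℕ → ℂ) (x y z : R) : ℂ :=
  2 * Complex.I * k 1 * (-2 * k 1 ^ 2 * K.M (a * K.I (a * K.I (a * K.I x)))
      + K.M (a * K.I (a * K.I b * K.I x)) - k 1 ^ 2 * K.M (a * K.I (a * K.I a * K.I x))
      + Complex.I * k 2 * K.M (a * K.I (a * K.I x)))
    - 2 * k 1 ^ 2 * K.M (a * K.I (a * K.I y)) + Complex.I * k 1 * K.M (a * K.I z)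

variable (K) in
/-- The abstract form of `ℛ⁽²⁾`, where `x`, `y` stand for `∑ v_p v_{n-3-p}`,
`∑ v_p v_{n-2-p}`. -/
noncomputable def calR2 (a u₂ : R) (k : ℕ → ℂ) (x y : R) : ℂ :=
  -2 * k 1 * K.M (a * u₂ * K.I (a * K.I x)) + Complex.I * K.M (a * u₂ * K.I y)

/-- Cancelling b against a² leaves only expressions in a, Ia and Ib, as produced by expanding u₂. -/
theorem calA1_eq (hab : a * b = 1) : K.calA1 a b k =
    (-4 * k 1 ^ 4) • (a * K.I (a * K.I (a * K.I a)))
    + (4 * k 1 ^ 2) • (a * K.I (a * K.I (a * K.I b)))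
    - a * K.I (a * ((k 1 ^ 2 • K.I a - K.I b) * (k 1 ^ 2 • K.I a - K.I b))) := by
  have h : -b * (k 1 ^ 2 • (a * K.I a) - a * K.I b) ^ 2 =
      -(a * ((k 1 ^ 2 • K.I a - K.I b) * (k 1 ^ 2 • K.I a - K.I b))) := by
    rw [← mul_smul_comm, ← mul_sub]
    linear_combination (-a * (k 1 ^ 2 • K.I a - K.I b) ^ 2) * hab
  rw [calA1, h, map_neg]
  ring

namespace Recursion

variable (h : K.Recursion a b k u n)
include h

theorem mean_five (hn : n = 5)
    (hk : 2 * K.M (a * K.I (a * K.I b)) * k 2 = -(Complex.I * K.M (K.calA1 a b k))) :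
    K.M (a * cauchy u 1 n) = 0 := by
  subst hn
  -- Up to a constant term, u₃ is a multiple of I(a u₂), so this is the mean of x Ix with x = a u₂.
  have h23 : K.M (a * (u 2 * u 3)) = 0 := by
    have h0 := h.mean_a_u2 (by norm_num)
    have h1 := K.M_self h0
    rw [h.three (by norm_num)]
    simp only [mul_add, mul_smul_comm, mul_one, map_add, map_smul, h0, ← mul_assoc, h1, smul_zero,
      add_zero]
  have hBA : K.I b * K.I a = K.I a * K.I b := mul_comm _ _
  have key : K.M (a * cauchy u 1 5) = 2 * Complex.I * k 1 *
      (K.M (K.calA1 a b k) - 2 * Complex.I * k 2 * K.M (a * K.I (a * K.I b))) := by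
    rw [cauchy_succ u (by norm_num), cauchy_succ u (by norm_num), cauchy_eq_zero u (by norm_num),
      add_zero, h.one, calA1_eq h.mul_eq_one, h.four (by norm_num)]
    simp only [mul_smul_comm, smul_mul_assoc, one_mul, mul_one, mul_add, map_add, map_smul,
      smul_eq_mul, h.mean_a, h23]
    simp only [h.three (by norm_num), h.two (by norm_num), mul_smul_comm, smul_mul_assoc, one_mul,
      mul_one, mul_add, add_mul, mul_sub, sub_mul, map_add, map_sub, map_smul,
      smul_eq_mul, hBA, K.M_self h.mean_a, K.M_I_self h.mean_a]
    ring_nf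
    simp only [Complex.I_sq, Complex.I_pow_three]
    ring
  rw [key]
  linear_combination (-2 * k 1 * Complex.I * Complex.I) * hk +
    (2 * k 1 * Complex.I * K.M (K.calA1 a b k)) * Complex.I_sq

/-- The κ₃² term disappears because M(a) = 0, so order 6 is still linear in κ₃. -/
theorem mean_a_u3_sq (hn : 3 < n) : K.M (a * (u 3 * u 3)) =
    -4 * K.M (K.calA4 a b k) + 4 * k 1 * K.M (a * K.I (a * K.I b)) * k 3 := by
  set x : R := (Complex.I * k 1 ^ 3) • K.I (a * K.I a) - (Complex.I * k 1) • K.I (a * K.I b)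
    + (k 1 * k 2) • K.I a with hx
  have h4 : K.calA4 a b k = a * (x * x) := by
    have : K.calA4 a b k = b * (a * x) ^ 2 := by
      rw [calA4, hx]
      simp only [mul_add, mul_sub, mul_smul_comm]
    rw [this]
    linear_combination (a * x ^ 2) * h.mul_eq_one
  have h3 : u 3 = (2 * Complex.I) • x + k 3 • (1 : R) := by
    rw [h.three hn, h.two (by omega), hx]
    simp only [mul_add, mul_sub, mul_smul_comm, mul_one, map_add, map_sub, map_smul]
    module
  have hax : 2 * Complex.I * K.M (a * x) = 2 * k 1 * K.M (a * K.I (a * K.I b)) := by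
    have := h.mean_a_u3 hn
    rw [h3, mul_add, mul_smul_comm, mul_smul_comm, map_add, map_smul, map_smul, mul_one, h.mean_a,
      smul_zero, add_zero, smul_eq_mul] at this
    exact this
  rw [h4, h3]
  simp only [mul_smul_comm, smul_mul_assoc, one_mul, mul_one, mul_add, add_mul, map_add, map_smul,
    smul_eq_mul, h.mean_a]
  linear_combination 2 * k 3 * hax + 4 * K.M (a * (x * x)) * Complex.I_sq

theorem mean_six (hn : n = 6)
    (hk : 4 * k 1 * K.M (a * K.I (a * K.I b)) * k 3 = 4 * K.M (K.calA4 a b k)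
      - K.M (K.calA3 a b k (a * (u 2 * u 2))) - K.M (K.calA2 a b k)) :
    K.M (a * cauchy u 1 n) = 0 := by
  subst hn
  have hBA : K.I b * K.I a = K.I a * K.I b := mul_comm _ _
  have key : K.M (a * cauchy u 1 6) = K.M (K.calA2 a b k)
      + K.M (K.calA3 a b k (a * (u 2 * u 2))) + K.M (a * (u 3 * u 3)) := by
    have h5 := h.step 5 (by norm_num) (by norm_num)
    rw [cauchy_succ u (by norm_num), cauchy_succ u (by norm_num),
      cauchy_eq_zero u (by norm_num), add_zero, h.one] at h5
    rw [cauchy_succ u (by norm_num), cauchy_succ u (by norm_num), cauchy_self u 3, h.one,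
      calA2, calA3, calA1_eq h.mul_eq_one, h5, h.four (by norm_num)]
    -- The square is evaluated separately by `mean_a_u3_sq`; in the remaining terms κ₃ cancels.
    generalize u 3 * u 3 = y
    simp only [h.three (by norm_num), h.two (by norm_num), mul_smul_comm, smul_mul_assoc, one_mul,
      mul_one, mul_add, add_mul, mul_sub, sub_mul, map_add, map_sub, map_smul, mul_assoc,
      smul_eq_mul, h.mean_a, h.mean_Q1, hBA, K.M_self h.mean_a, K.M_I_self h.mean_a,
      K.M_sq_self h.mean_a, K.M_triple h.mean_a h.mean_Q1]
    ring_nf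
    simp only [Complex.I_sq, Complex.I_pow_three, Complex.I_pow_four]
    ring
  rw [key, h.mean_a_u3_sq (by norm_num), hk]
  ring

/-- For κ_{n-3}, the contributions 4iκ₁M(a I(a u₂)) and 4iκ₁M(a u₂ Ia) cancel by partial
integration; only 2M(a u₃) remains. The bound n ≥ 7 keeps u_{n-3} apart from u₃. -/
theorem mean_of_seven_le (hn : 7 ≤ n) (hμ : k 1 * K.M (a * K.I (a * K.I b)) ≠ 0)
    (hk : k (n - 3) = (-1) / (4 * k 1 * K.M (a * K.I (a * K.I b))) *
      (K.M (a * cauchy u 4 n)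
        + 2 * K.calR1 a b k (a * cauchy u 1 (n - 3)) (a * cauchy u 2 (n - 2))
          (a * cauchy u 3 (n - 1))
        + 2 * K.calR2 a (u 2) k (a * cauchy u 1 (n - 3)) (a * cauchy u 2 (n - 2))
        + 2 * K.M (u 3 * (a * (Complex.I • K.I (a * cauchy u 1 (n - 3))))))) :
    K.M (a * cauchy u 1 n) = 0 := by
  have hBA : K.I b * K.I a = K.I a * K.I b := mul_comm _ _
  have h1 := h.step (n - 1) (by omega) (by omega)
  have h2 := h.step (n - 2) (by omega) (by omega)
  have h3 := h.step (n - 3) (by omega) (by omega)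
  rw [cauchy_succ u (by omega), cauchy_succ u (by omega), h.one, show n - 1 - 1 = n - 2 by omega,
    show n - 1 - (1 + 1) = n - 3 by omega] at h1
  rw [cauchy_succ u (by omega), h.one, show n - 2 - 1 = n - 3 by omega] at h2
  have key : K.M (a * cauchy u 1 n) = K.M (a * cauchy u 4 n)
        + 2 * K.calR1 a b k (a * cauchy u 1 (n - 3)) (a * cauchy u 2 (n - 2))
          (a * cauchy u 3 (n - 1))
        + 2 * K.calR2 a (u 2) k (a * cauchy u 1 (n - 3)) (a * cauchy u 2 (n - 2))
        + 2 * K.M (u 3 * (a * (Complex.I • K.I (a * cauchy u 1 (n - 3)))))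
        + 4 * k 1 * K.M (a * K.I (a * K.I b)) * k (n - 3) := by
    rw [cauchy_succ u (by omega), cauchy_succ u (by omega), cauchy_succ u (by omega), h.one,
      mul_left_comm (u 3), h1, h2, h3, calR1, calR2]
    norm_num only
    generalize cauchy u 4 n = g₄
    generalize cauchy u 3 (n - 1) = g₃
    generalize cauchy u 2 (n - 2) = g₂
    generalize K.I (a * cauchy u 1 (n - 3)) = y
    have hm := h.mean_a_u3 (by omega)
    generalize u 3 = u₃ at *
    simp only [h.two (by omega), mul_smul_comm, smul_mul_assoc, one_mul,
      mul_one, mul_add, add_mul, mul_sub, sub_mul, map_add, map_sub, map_smul, mul_assoc,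
      smul_eq_mul, h.mean_a, h.mean_Q1, hBA, K.M_self h.mean_a, K.M_I_self h.mean_a,
      K.M_sq_self h.mean_a, K.M_triple h.mean_a h.mean_Q1, hm]
    ring_nf
    simp only [Complex.I_sq, Complex.I_pow_three]
    ring
  have hμ' : 4 * k 1 * K.M (a * K.I (a * K.I b)) ≠ 0 := by
    rw [mul_assoc]
    exact mul_ne_zero (by norm_num) hμ
  have hcancel : ∀ d x : ℂ, d ≠ 0 → d * (-1 / d * x) = -x := fun d x hd => by
    field_simp
  rw [key, hk, hcancel _ _ hμ']
  ring

end Recursion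

end MeanCalculus

/-! ### Differentiating the coefficients -/

section Derivative

theorem hasDerivAt_integral {G : ℝ → ℂ} (hG : Continuous G) (t : ℝ) :
    HasDerivAt (fun t => ∫ τ in (0 : ℝ)..t, G τ) (G t) t :=
  (hG.integral_hasStrictDerivAt 0 t).hasDerivAt

theorem continuous_integral {G : ℝ → ℂ} (hG : Continuous G) :
    Continuous fun t => ∫ τ in (0 : ℝ)..t, G τ :=
  continuous_iff_continuousAt.2 fun t => (hasDerivAt_integral hG t).continuousAt

variable {f : ℝ → ℝ}

theorem hasDerivAt_q (hf : Continuous f) (t : ℝ) :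
    HasDerivAt (q f) (Complex.I * f t * q f t) t := by
  have h1 : HasDerivAt (fun t : ℝ => ((∫ τ in (0 : ℝ)..t, f τ : ℝ) : ℂ)) (f t : ℂ) t :=
    (hf.integral_hasStrictDerivAt 0 t).hasDerivAt.ofReal_comp
  have := (h1.const_mul Complex.I).cexp
  rw [mul_comm (Complex.exp _)] at this
  exact this

theorem continuous_q (hf : Continuous f) : Continuous (q f) :=
  continuous_iff_continuousAt.2 fun t => (hasDerivAt_q hf t).continuousAt

theorem Q0_ne_zero (f : ℝ → ℝ) (t : ℝ) : Q0 f t ≠ 0 := pow_ne_zero 2 (q_ne_zero f t)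

theorem continuous_Q0 (hf : Continuous f) : Continuous (Q0 f) := (continuous_q hf).pow 2

theorem v_two (f : ℝ → ℝ) (κ : ℕ → ℂ) (t : ℝ) : v f κ 2 t = q f t *
    (Complex.I * (∫ τ in (0 : ℝ)..t, (κ 1 ^ 2 * Q0 f τ - (Q0 f τ)⁻¹)) + κ 2) := by
  rw [v]

theorem v_one (f : ℝ → ℝ) (κ : ℕ → ℂ) (t : ℝ) : v f κ 1 t = κ 1 * q f t := by
  rw [v]

theorem continuous_v (hf : Continuous f) (κ : ℕ → ℂ) (n : ℕ) : Continuous (v f κ n) := by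
  induction n using Nat.strong_induction_on with
  | _ n ih =>
    match n with
    | 0 =>
      have : v f κ 0 = fun _ => 0 := by rw [v]
      rw [this]; exact continuous_const
    | 1 =>
      rw [funext (v_one f κ)]
      exact continuous_const.mul (continuous_q hf)
    | 2 =>
      rw [funext (v_two f κ)]
      refine (continuous_q hf).mul ((continuous_const.mul (continuous_integral ?_)).add
        continuous_const)
      exact (continuous_const.mul (continuous_Q0 hf)).sub
        ((continuous_Q0 hf).inv₀ (Q0_ne_zero f))
    | n + 3 =>
      rw [funext (v_eq f κ (n + 3) (by omega))]
      refine (continuous_q hf).mul ((continuous_const.mul (continuous_integral ?_)).add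
        continuous_const)
      refine continuous_finsetSum _ fun p hp => ?_
      rw [Finset.mem_Ico] at hp
      exact (ih p (by omega)).mul (ih _ (by omega))

/-- The coefficients of `g` satisfy the recursion of the generalised Riccati equation, whatever
the integration constants are. -/
theorem hasDerivAt_g (hf : Continuous f) (κ : ℕ → ℂ) {n : ℕ} (hn : 1 ≤ n) (t : ℝ) :
    HasDerivAt (g f κ n) (Complex.I * (∑ p ∈ Finset.Ico 1 n, g f κ p t * g f κ (n - p) t)
      + 2 * Complex.I * (f t : ℂ) * g f κ n t - (if n = 2 then Complex.I else 0)) t := by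
  have hq := hasDerivAt_q hf t
  match n, hn with
  | 1, _ =>
    have h1 : g f κ 1 = fun t => κ 1 * (q f t * q f t) := by
      funext t
      rw [g, v_one]; ring
    rw [h1]
    refine ((hq.mul hq).const_mul (κ 1)).congr_deriv ?_
    simp
    ring
  | 2, _ =>
    have h1 : g f κ 2 = fun t => q f t * (q f t *
        (Complex.I * (∫ τ in (0 : ℝ)..t, (κ 1 ^ 2 * Q0 f τ - (Q0 f τ)⁻¹)) + κ 2)) := by
      funext t
      rw [g, v_two]
    have hG : Continuous fun τ => κ 1 ^ 2 * Q0 f τ - (Q0 f τ)⁻¹ :=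
      (continuous_const.mul (continuous_Q0 hf)).sub ((continuous_Q0 hf).inv₀ (Q0_ne_zero f))
    have hd := hq.mul (hq.mul (((hasDerivAt_integral hG t).const_mul Complex.I).add_const (κ 2)))
    rw [h1]
    refine hd.congr_deriv ?_
    have h2 : ∑ p ∈ Finset.Ico 1 2, g f κ p t * g f κ (2 - p) t =
        κ 1 ^ 2 * q f t ^ 4 := by
      simp [g, v_one]; ring
    rw [h2, if_pos rfl]
    have h3 : q f t ^ 2 * (q f t ^ 2)⁻¹ = 1 :=
      mul_inv_cancel₀ (pow_ne_zero 2 (q_ne_zero f t))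
    simp only [Q0, Pi.mul_apply]
    linear_combination (-Complex.I) * h3
  | n + 3, _ =>
    have h1 : g f κ (n + 3) = fun t => q f t * (q f t * (Complex.I * (∫ τ in (0 : ℝ)..t,
        ∑ p ∈ Finset.Ico 1 (n + 3), v f κ p τ * v f κ (n + 3 - p) τ) + κ (n + 3))) := by
      funext t
      rw [g, v_eq f κ (n + 3) (by omega)]
    have hG : Continuous fun τ =>
        ∑ p ∈ Finset.Ico 1 (n + 3), v f κ p τ * v f κ (n + 3 - p) τ :=
      continuous_finsetSum _ fun p _ => (continuous_v hf κ p).mul (continuous_v hf κ _)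
    have hd := hq.mul (hq.mul
      (((hasDerivAt_integral hG t).const_mul Complex.I).add_const (κ (n + 3))))
    have h2 : ∑ p ∈ Finset.Ico 1 (n + 3), g f κ p t * g f κ (n + 3 - p) t =
        q f t ^ 2 * ∑ p ∈ Finset.Ico 1 (n + 3), v f κ p t * v f κ (n + 3 - p) t := by
      rw [Finset.mul_sum]
      refine Finset.sum_congr rfl fun p _ => ?_
      simp only [g]; ring
    rw [h2, if_neg (by omega), h1]
    refine hd.congr_deriv ?_
    simp only [Pi.mul_apply]
    ring

end Derivative

/-! ### Existence of the integration constants -/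

section Existence

theorem v_congr (f : ℝ → ℝ) {κ κ' : ℕ → ℂ} {n : ℕ} (h : ∀ j ≤ n, κ j = κ' j) :
    v f κ n = v f κ' n := by
  induction n using Nat.strong_induction_on with
  | _ n ih =>
    funext t
    match n with
    | 0 => rw [v, v]
    | 1 => rw [v_one, v_one, h 1 le_rfl]
    | 2 => rw [v_two, v_two, h 1 (by norm_num), h 2 le_rfl]
    | n + 3 =>
      rw [v_eq f κ _ (by omega), v_eq f κ' _ (by omega), h (n + 3) le_rfl]
      congr 3
      refine congrArg (fun G : ℝ → ℂ => ∫ τ in (0 : ℝ)..t, G τ) (funext fun τ => ?_)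
      refine Finset.sum_congr rfl fun p hp => ?_
      rw [Finset.mem_Ico] at hp
      rw [ih p (by omega) fun j hj => h j (by omega),
        ih (n + 3 - p) (by omega) fun j hj => h j (by omega)]

/-- The right-hand sides of the recursive choice of the integration constants. -/
noncomputable def kappaRhs (f : ℝ → ℝ) (c : ℂ) (κ : ℕ → ℂ) : ℕ → ℂ
  | 0 => 0
  | 1 => c
  | 2 => -(Complex.I * mean (A1 f κ)) / (2 * mean (Q3 f))
  | 3 => (4 * mean (A4 f κ) - mean (A3 f κ) - mean (A2 f κ)) / (4 * κ 1 * mean (Q3 f))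
  | n + 4 => (-1) / (4 * κ 1 * mean (Q3 f)) *
      ((∑ p ∈ Finset.Icc 4 (n + 7 - 4), mean (vv f κ p (n + 7 - p))) + 2 * R1 f κ (n + 7)
        + 2 * R2 f κ (n + 7) + 2 * mean (fun t => (q f t)⁻¹ * v f κ 3 t * l f κ (n + 7 - 3) t))

/-- Makes the recursion well-founded: κ_{n+4} comes from order n + 7, whose right-hand side uses
indices up to n + 3 only. -/
theorem kappaRhs_congr (f : ℝ → ℝ) (c : ℂ) {κ κ' : ℕ → ℂ} {n : ℕ} (h : ∀ j < n, κ j = κ' j) :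
    kappaRhs f c κ n = kappaRhs f c κ' n := by
  have hv : ∀ p < n, v f κ p = v f κ' p := fun p hp => v_congr f fun j hj => h j (by omega)
  have hvv : ∀ p r, p < n → r < n → vv f κ p r = vv f κ' p r := fun p r hp hr => by
    funext t
    rw [vv, vv, hv p hp, hv r hr]
  have hA1 : 2 ≤ n → A1 f κ = A1 f κ' := fun hn => by
    have hs : s f κ = s f κ' := by
      funext t
      rw [s, s, h 1 (by omega)]
    funext t
    rw [A1, A1, h 1 (by omega), hs]
  match n with
  | 0 => rfl
  | 1 => rfl
  | 2 => rw [kappaRhs, kappaRhs, hA1 le_rfl]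
  | 3 =>
    have h1 := h 1 (by norm_num)
    have h2 := h 2 (by norm_num)
    have e2 : A2 f κ = A2 f κ' := by
      funext t
      rw [A2, A2, h1, h2, hA1 (by norm_num)]
    have e3 : A3 f κ = A3 f κ' := by
      funext t
      rw [A3, A3, h1, h2, hvv 2 2 (by norm_num) (by norm_num)]
    have e4 : A4 f κ = A4 f κ' := by
      funext t
      rw [A4, A4, h1, h2]
    rw [kappaRhs, kappaRhs, e2, e3, e4, h1]
  | n + 4 =>
    have h1 := h 1 (by omega)
    have h2 := h 2 (by omega)
    have e0 : ∑ p ∈ Finset.Icc 4 (n + 7 - 4), mean (vv f κ p (n + 7 - p)) =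
        ∑ p ∈ Finset.Icc 4 (n + 7 - 4), mean (vv f κ' p (n + 7 - p)) := by
      refine Finset.sum_congr rfl fun p hp => ?_
      rw [Finset.mem_Icc] at hp
      rw [hvv p _ (by omega) (by omega)]
    have e1 : R1 f κ (n + 7) = R1 f κ' (n + 7) := by
      rw [R1, R1, h1, h2]
      refine congrArg₂ HAdd.hAdd (congrArg₂ HSub.hSub (congrArg _ ?_) (congrArg _ ?_))
        (congrArg _ ?_) <;>
      · refine Finset.sum_congr rfl fun p hp => ?_
        rw [Finset.mem_Icc] at hp
        rw [hvv p _ (by omega) (by omega)]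
    have e2 : R2 f κ (n + 7) = R2 f κ' (n + 7) := by
      rw [R2, R2, h1, hv 2 (by omega)]
      refine congrArg₂ HAdd.hAdd (congrArg _ ?_) (congrArg _ ?_) <;>
      · refine Finset.sum_congr rfl fun p hp => ?_
        rw [Finset.mem_Icc] at hp
        rw [hvv p _ (by omega) (by omega)]
    have e3 : l f κ (n + 7 - 3) = l f κ' (n + 7 - 3) := by
      funext t
      rw [l, l]
      congr 1
      refine congrArg (fun G : ℝ → ℂ => ∫ τ in (0 : ℝ)..t, G τ) (funext fun τ => ?_)
      refine Finset.sum_congr rfl fun p hp => ?_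
      rw [Finset.mem_Ico] at hp
      rw [hv p (by omega), hv _ (by omega)]
    rw [kappaRhs, kappaRhs, e0, e1, e2, e3, h1, hv 3 (by omega)]

/-- The integration constants beginning with `c`. -/
noncomputable def kappaSeq (f : ℝ → ℝ) (c : ℂ) (n : ℕ) : ℂ :=
  -- The default 0 has no influence, by `kappaRhs_congr`.
  kappaRhs f c (fun j => if _h : j < n then kappaSeq f c j else 0) n
termination_by n

theorem kappaSeq_eq (f : ℝ → ℝ) (c : ℂ) (n : ℕ) :
    kappaSeq f c n = kappaRhs f c (kappaSeq f c) n := by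
  conv_lhs => rw [kappaSeq]
  exact kappaRhs_congr f c fun j hj => dif_pos hj

theorem isSecularFreeChoice_kappaSeq (f : ℝ → ℝ) {c : ℂ}
    (hc : c ^ 2 = (starRingEnd ℂ) (mean (Q3 f)) / mean (Q3 f)) :
    kappaSeq f c 1 = c ∧ IsSecularFreeChoice f (kappaSeq f c) := by
  have h1 : kappaSeq f c 1 = c := kappaSeq_eq f c 1
  refine ⟨h1, by rw [h1, hc], kappaSeq_eq f c 2, kappaSeq_eq f c 3, fun n hn => ?_⟩
  obtain ⟨m, rfl⟩ := Nat.exists_eq_add_of_le' hn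
  exact kappaSeq_eq f c (m + 4)

end Existence

/-! ### Quasi-periodicity -/

section QuasiPeriodic

/-- Negative basic frequencies change sign together with their indices; vanishing ones become 1 with
index 0. Coefficients sharing an index are then summed over fibres. -/
theorem isQuasiPeriodic_of_hasSum {B : ℕ} (hB : 0 < B) (ω : Fin B → ℝ) {h : ℝ → ℂ} {ι : Type}
    {c : ι → ℂ} {m : ι → Fin B → ℤ} (hc : Summable fun i => ‖c i‖)
    (hh : ∀ t, HasSum (fun i => c i * expo (freq ω (m i)) t) (h t)) : IsQuasiPeriodic h := by
  set ω' : Fin B → ℝ := fun j => if ω j = 0 then 1 else |ω j| with hω'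
  set m' : ι → Fin B → ℤ := fun i j => (SignType.sign (ω j) : ℤ) * m i j with hm'
  have hfreq : ∀ i, freq ω' (m' i) = freq ω (m i) := by
    intro i
    refine Finset.sum_congr rfl fun j _ => ?_
    simp only [hω', hm']
    rcases lt_trichotomy (ω j) 0 with hj | hj | hj
    · rw [if_neg hj.ne, sign_neg hj, abs_of_neg hj]; push_cast; simp
    · rw [if_pos hj, hj]; simp
    · rw [if_neg hj.ne', sign_pos hj, abs_of_pos hj]; push_cast; simp
  refine ⟨B, ω', fun n => ∑' i : m' ⁻¹' {n}, c i, hB, fun j => ?_, ?_, fun t => ?_⟩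
  · simp only [hω']
    split_ifs with hj
    · exact one_pos
    · exact abs_pos.2 hj
  · refine Summable.of_nonneg_of_le (fun _ => norm_nonneg _) (fun n => ?_)
      (hc.hasSum.tsum_fiberwise m').summable
    exact norm_tsum_le_tsum_norm (hc.subtype _)
  · have h1 := (hh t).tsum_fiberwise m'
    refine h1.congr_fun fun n => ?_
    rw [← tsum_mul_right]
    refine tsum_congr fun i => ?_
    have : m' i = n := i.2
    rw [← hfreq, this, expo]

/-- Taking θ as an additional basic frequency, θ + m·ω + 2kθ has the odd coefficient 2k + 1 at θ. -/
theorem Rep.isQuasiPeriodic {A : ℕ} {ω : Fin A → ℝ} {θ : ℝ} {W : (Fin A → ℤ) × ℤ → ℝ}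
    {S : Set ((Fin A → ℤ) × ℤ)} {h : ℝ → ℂ} (hh : Rep (freqExt ω θ) W S h) :
    IsQuasiPeriodic fun t => expo θ t * h t := by
  obtain ⟨B, ι, hι, c, γ, he⟩ := hh
  refine isQuasiPeriodic_of_hasSum (B := A + 1) (Nat.succ_pos A) (Fin.cons θ ω)
    (c := c) (m := fun i => Fin.cons (2 * (γ i).2 + 1) (γ i).1) he.summable_norm fun t => ?_
  refine ((he.hasSum t).mul_left (expo θ t)).congr_fun fun i => ?_
  have : freq (Fin.cons θ ω : Fin (A + 1) → ℝ) (Fin.cons (2 * (γ i).2 + 1) (γ i).1) =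
      θ + freqExt ω θ (γ i) := by
    rw [freq, Fin.sum_univ_succ]
    simp only [Fin.cons_zero, Fin.cons_succ]
    change _ = θ + (freq ω (γ i).1 + (γ i).2 * (2 * θ))
    rw [freq]
    push_cast
    ring
  rw [this, expo_add]
  ring

end QuasiPeriodic

/-! ### The mean values of the coefficients vanish -/

section Secular

variable {Γ : Type} [AddCommGroup Γ] {φ : Γ →+ ℝ} {W : Γ → ℝ}

theorem Rep.mean_conj {S : Set Γ} {h : ℝ → ℂ} (hh : Rep φ W S h) :
    mean (fun t => (starRingEnd ℂ) (h t)) = (starRingEnd ℂ) (mean h) :=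
  hh.hasMean.conj.mean_eq

theorem Rep.prim_conj {S : Set Γ} {h : ℝ → ℂ} (hh : Rep φ W S h) (t : ℝ) :
    QPRiccati.prim (fun t => (starRingEnd ℂ) (h t)) t =
      (starRingEnd ℂ) (QPRiccati.prim h t) := by
  rw [QPRiccati.prim, QPRiccati.prim, hh.mean_conj]
  simp only [intervalIntegral, ← map_sub, integral_conj]

theorem conj_q (f : ℝ → ℝ) (t : ℝ) : (starRingEnd ℂ) (q f t) = (q f t)⁻¹ := by
  rw [q, ← Complex.exp_conj, ← Complex.exp_neg, map_mul, Complex.conj_I, Complex.conj_ofReal,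
    neg_mul]

theorem conj_Q0 (f : ℝ → ℝ) (t : ℝ) : (starRingEnd ℂ) (Q0 f t) = (Q0 f t)⁻¹ := by
  rw [Q0, map_pow, conj_q, inv_pow]

theorem conj_Q0_inv (f : ℝ → ℝ) (t : ℝ) : (starRingEnd ℂ) (Q0 f t)⁻¹ = Q0 f t := by
  rw [← conj_Q0, Complex.conj_conj]

variable {hW : IsWeight W} {hdiv : ∀ γ, φ γ ≠ 0 → 1 / W γ ≤ |φ γ|} {f : ℝ → ℝ} {κ : ℕ → ℂ}
  {a b : expAlgebra φ hW}

theorem mean_coe (x : expAlgebra φ hW) : mean (x : ℝ → ℂ) = (expCalculus φ hW hdiv).M x := rfl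

theorem ren_coe (x y : expAlgebra φ hW) : ren (x : ℝ → ℂ) (y : ℝ → ℂ) =
    ((x * (expCalculus φ hW hdiv).I y : expAlgebra φ hW) : ℝ → ℂ) := rfl

theorem prim_coe (x : expAlgebra φ hW) :
    (((expCalculus φ hW hdiv).I x : expAlgebra φ hW) : ℝ → ℂ) = prim (x : ℝ → ℂ) := rfl

/-- As |Q₀| = 1, conjugation exchanges a and b and commutes with M and I. -/
theorem mean_conj_Q3 (ha : (a : ℝ → ℂ) = Q0 f) (hb : (b : ℝ → ℂ) = fun t => (Q0 f t)⁻¹) :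
    (expCalculus φ hW hdiv).M (b * (expCalculus φ hW hdiv).I (b * (expCalculus φ hW hdiv).I a)) =
      (starRingEnd ℂ) (mean (Q3 f)) := by
  set K := expCalculus φ hW hdiv
  have hconj : ∀ x : expAlgebra φ hW, ∀ y : expAlgebra φ hW,
      (∀ t, (x : ℝ → ℂ) t = (starRingEnd ℂ) ((y : ℝ → ℂ) t)) → ∀ t,
      ((K.I x : expAlgebra φ hW) : ℝ → ℂ) t =
        (starRingEnd ℂ) (((K.I y : expAlgebra φ hW) : ℝ → ℂ) t) := by
    intro x y h t
    rw [prim_coe, prim_coe, ← Rep.prim_conj y.2, funext h]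
  have hab : ∀ t, (b : ℝ → ℂ) t = (starRingEnd ℂ) ((a : ℝ → ℂ) t) := fun t => by
    rw [ha, hb, conj_Q0]
  have hba : ∀ t, (a : ℝ → ℂ) t = (starRingEnd ℂ) ((b : ℝ → ℂ) t) := fun t => by
    rw [ha, hb, conj_Q0_inv]
  have hQ3 : Q3 f = ((a * K.I (a * K.I b) : expAlgebra φ hW) : ℝ → ℂ) := by
    rw [Q3, Q1, ← hb, ← ha]
    rfl
  rw [hQ3, ← Rep.mean_conj (a * K.I (a * K.I b)).2, ← mean_coe]
  congr 1
  funext t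
  have h1 := hconj (b * K.I a) (a * K.I b) fun t => by
    simp only [Subalgebra.coe_mul, Pi.mul_apply, map_mul, ← hab, ← hconj a b hba]
  simp only [Subalgebra.coe_mul, Pi.mul_apply, map_mul, ← hab, h1]

/-- The quotient `v_n / q`. -/
noncomputable def vq (f : ℝ → ℝ) (κ : ℕ → ℂ) (n : ℕ) (t : ℝ) : ℂ := (q f t)⁻¹ * v f κ n t

theorem v_eq_vq (f : ℝ → ℝ) (κ : ℕ → ℂ) (n : ℕ) (t : ℝ) : v f κ n t = q f t * vq f κ n t := by
  rw [vq, mul_inv_cancel_left₀ (q_ne_zero f t)]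

open Classical in
variable (hW φ) in
/-- The quotients `v_n / q` as elements of the algebra of exponential sums. -/
noncomputable def vqAlg (f : ℝ → ℝ) (κ : ℕ → ℂ) (n : ℕ) : expAlgebra φ hW :=
  if h : vq f κ n ∈ expAlgebra φ hW then ⟨vq f κ n, h⟩ else 0

theorem coe_vqAlg {n : ℕ} (h : vq f κ n ∈ expAlgebra φ hW) :
    (vqAlg φ hW f κ n : ℝ → ℂ) = vq f κ n := by
  rw [vqAlg, dif_pos h]

theorem vv_eq {p r : ℕ} (ha : (a : ℝ → ℂ) = Q0 f) (hp : vq f κ p ∈ expAlgebra φ hW)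
    (hr : vq f κ r ∈ expAlgebra φ hW) : vv f κ p r =
      ((a * (vqAlg φ hW f κ p * vqAlg φ hW f κ r) : expAlgebra φ hW) : ℝ → ℂ) := by
  funext t
  simp only [Subalgebra.coe_mul, Pi.mul_apply, coe_vqAlg hp, coe_vqAlg hr, ha, vv, v_eq_vq, Q0]
  ring

theorem coe_cauchy {n j m : ℕ} (ha : (a : ℝ → ℂ) = Q0 f)
    (hu : ∀ p, 1 ≤ p → p < n → vq f κ p ∈ expAlgebra φ hW) (hj : 1 ≤ j) (hm : m < n + j) (t : ℝ) :
    ((a * MeanCalculus.cauchy (vqAlg φ hW f κ) j m : expAlgebra φ hW) : ℝ → ℂ) t =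
      ∑ p ∈ Finset.Ico j (m + 1 - j), v f κ p t * v f κ (m - p) t := by
  rw [MeanCalculus.cauchy, Finset.mul_sum, AddSubmonoidClass.coe_finsetSum, Finset.sum_apply]
  refine Finset.sum_congr rfl fun p hp => ?_
  rw [Finset.mem_Ico] at hp
  rw [← vv_eq ha (hu p (by omega) (by omega)) (hu (m - p) (by omega) (by omega)), vv]

/-- Φ need only be linear on the algebra, as is the case for means. With p ≥ j and m < n + j, all
indices stay below n. -/
theorem sum_vv {n j m N : ℕ} (ha : (a : ℝ → ℂ) = Q0 f)
    (hu : ∀ p, 1 ≤ p → p < n → vq f κ p ∈ expAlgebra φ hW) (hj : 1 ≤ j) (hm : m < n + j)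
    (hN : N + 1 = m + 1 - j) (Φ : (ℝ → ℂ) → ℂ) (L : expAlgebra φ hW →ₗ[ℂ] ℂ)
    (hΦ : ∀ x : expAlgebra φ hW, Φ (x : ℝ → ℂ) = L x) :
    ∑ p ∈ Finset.Icc j N, Φ (vv f κ p (m - p)) =
      L (a * MeanCalculus.cauchy (vqAlg φ hW f κ) j m) := by
  have hI : Finset.Icc j N = Finset.Ico j (m + 1 - j) := by
    ext p
    simp only [Finset.mem_Icc, Finset.mem_Ico]
    omega
  rw [MeanCalculus.cauchy, Finset.mul_sum, map_sum, hI]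
  refine Finset.sum_congr rfl fun p hp => ?_
  rw [Finset.mem_Ico] at hp
  rw [vv_eq ha (hu p (by omega) (by omega)) (hu (m - p) (by omega) (by omega)), hΦ]

end Secular

/-! ### Translation into the abstract calculus and the main induction. -/

section Assembly

variable {Γ : Type} [AddCommGroup Γ] {φ : Γ →+ ℝ} {W : Γ → ℝ}
variable {hW : IsWeight W} {hdiv : ∀ γ, φ γ ≠ 0 → 1 / W γ ≤ |φ γ|} {f : ℝ → ℝ} {κ : ℕ → ℂ}
  {a b : expAlgebra φ hW}

theorem Q1_coe (ha : (a : ℝ → ℂ) = Q0 f) (hb : (b : ℝ → ℂ) = fun t => (Q0 f t)⁻¹) :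
    Q1 f = ((a * (expCalculus φ hW hdiv).I b : expAlgebra φ hW) : ℝ → ℂ) := by
  rw [Q1, ← hb, ← ha]
  rfl

theorem Q2_coe (ha : (a : ℝ → ℂ) = Q0 f) :
    Q2 f = ((a * (expCalculus φ hW hdiv).I a : expAlgebra φ hW) : ℝ → ℂ) := by
  rw [Q2, ← ha]
  rfl

theorem Q3_coe (ha : (a : ℝ → ℂ) = Q0 f) (hb : (b : ℝ → ℂ) = fun t => (Q0 f t)⁻¹) :
    Q3 f = ((a * (expCalculus φ hW hdiv).I (a * (expCalculus φ hW hdiv).I b) :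
      expAlgebra φ hW) : ℝ → ℂ) := by
  rw [Q3, Q1_coe ha hb, ← ha]
  rfl

theorem A1_coe (ha : (a : ℝ → ℂ) = Q0 f) (hb : (b : ℝ → ℂ) = fun t => (Q0 f t)⁻¹) :
    A1 f κ = ((expCalculus φ hW hdiv).calA1 a b κ : ℝ → ℂ) := by
  have hs : s f κ = ((-b * (κ 1 ^ 2 • (a * (expCalculus φ hW hdiv).I a)
      - a * (expCalculus φ hW hdiv).I b) ^ 2 : expAlgebra φ hW) : ℝ → ℂ) := by
    funext t
    rw [s, Q1_coe (hdiv := hdiv) ha hb, Q2_coe (hdiv := hdiv) ha]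
    simp [hb]
  funext t
  rw [A1, hs, Q1_coe (hdiv := hdiv) ha hb, Q2_coe (hdiv := hdiv) ha, ← ha]
  rfl

theorem A2_coe (ha : (a : ℝ → ℂ) = Q0 f) (hb : (b : ℝ → ℂ) = fun t => (Q0 f t)⁻¹) :
    A2 f κ = ((expCalculus φ hW hdiv).calA2 a b κ : ℝ → ℂ) := by
  funext t
  rw [A2, A1_coe (hdiv := hdiv) ha hb, Q1_coe (hdiv := hdiv) ha hb, Q2_coe (hdiv := hdiv) ha, ← ha]
  rfl

theorem A3_coe (ha : (a : ℝ → ℂ) = Q0 f) (hb : (b : ℝ → ℂ) = fun t => (Q0 f t)⁻¹)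
    (h2 : vq f κ 2 ∈ expAlgebra φ hW) :
    A3 f κ = ((expCalculus φ hW hdiv).calA3 a b κ
      (a * (vqAlg φ hW f κ 2 * vqAlg φ hW f κ 2)) : ℝ → ℂ) := by
  funext t
  rw [A3, vv_eq ha h2 h2, Q1_coe (hdiv := hdiv) ha hb, Q2_coe (hdiv := hdiv) ha, ← ha]
  rfl

theorem A4_coe (ha : (a : ℝ → ℂ) = Q0 f) (hb : (b : ℝ → ℂ) = fun t => (Q0 f t)⁻¹) :
    A4 f κ = ((expCalculus φ hW hdiv).calA4 a b κ : ℝ → ℂ) := by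
  funext t
  have hb' : (Q0 f t)⁻¹ = (b : ℝ → ℂ) t := by rw [hb]
  rw [A4, hb', Q1_coe (hdiv := hdiv) ha hb, Q2_coe (hdiv := hdiv) ha, ← ha]
  simp only [ren_coe (hdiv := hdiv), MeanCalculus.calA4, sq]
  rfl

theorem R1_coe {n : ℕ} (hn : 7 ≤ n) (ha : (a : ℝ → ℂ) = Q0 f)
    (hb : (b : ℝ → ℂ) = fun t => (Q0 f t)⁻¹)
    (hu : ∀ p, 1 ≤ p → p < n → vq f κ p ∈ expAlgebra φ hW) :
    R1 f κ n = (expCalculus φ hW hdiv).calR1 a b κ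
      (a * MeanCalculus.cauchy (vqAlg φ hW f κ) 1 (n - 3))
      (a * MeanCalculus.cauchy (vqAlg φ hW f κ) 2 (n - 2))
      (a * MeanCalculus.cauchy (vqAlg φ hW f κ) 3 (n - 1)) := by
  let K := expCalculus φ hW hdiv
  let J : expAlgebra φ hW → expAlgebra φ hW →ₗ[ℂ] expAlgebra φ hW :=
    fun x => LinearMap.mulLeft ℂ x ∘ₗ K.I
  rw [R1, Q1_coe (hdiv := hdiv) ha hb, Q2_coe (hdiv := hdiv) ha, ← ha,
    sum_vv ha hu le_rfl (by omega) (by omega)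
      (fun x => -2 * κ 1 ^ 2 * mean (ren4 a a a x)
        + mean (ren3 a ↑(a * K.I b) x) - κ 1 ^ 2 * mean (ren3 a ↑(a * K.I a) x)
        + Complex.I * κ 2 * mean (ren3 a a x))
      ((-2 * κ 1 ^ 2) • (K.M ∘ₗ J a ∘ₗ J a ∘ₗ J a) + K.M ∘ₗ J a ∘ₗ J (a * K.I b)
        - κ 1 ^ 2 • (K.M ∘ₗ J a ∘ₗ J (a * K.I a)) + (Complex.I * κ 2) • (K.M ∘ₗ J a ∘ₗ J a))
      (fun _ => rfl),
    sum_vv ha hu (by norm_num) (by omega) (by omega) (fun x => mean (ren3 a a x))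
      (K.M ∘ₗ J a ∘ₗ J a) (fun _ => rfl),
    sum_vv ha hu (by norm_num) (by omega) (by omega) (fun x => mean (ren a x))
      (K.M ∘ₗ J a) (fun _ => rfl)]
  rfl

theorem R2_coe {n : ℕ} (hn : 7 ≤ n) (ha : (a : ℝ → ℂ) = Q0 f)
    (hu : ∀ p, 1 ≤ p → p < n → vq f κ p ∈ expAlgebra φ hW) :
    R2 f κ n = (expCalculus φ hW hdiv).calR2 a (vqAlg φ hW f κ 2) κ
      (a * MeanCalculus.cauchy (vqAlg φ hW f κ) 1 (n - 3))
      (a * MeanCalculus.cauchy (vqAlg φ hW f κ) 2 (n - 2)) := by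
  let K := expCalculus φ hW hdiv
  let J : expAlgebra φ hW → expAlgebra φ hW →ₗ[ℂ] expAlgebra φ hW :=
    fun x => LinearMap.mulLeft ℂ x ∘ₗ K.I
  have h2 : (fun t => q f t * v f κ 2 t) = ((a * vqAlg φ hW f κ 2 : expAlgebra φ hW) : ℝ → ℂ) := by
    funext t
    rw [Subalgebra.coe_mul, Pi.mul_apply, coe_vqAlg (hu 2 (by norm_num) (by omega)), ha, Q0,
      v_eq_vq]
    ring
  rw [R2, h2, ← ha,
    sum_vv ha hu le_rfl (by omega) (by omega)
      (fun x => mean (ren3 ↑(a * vqAlg φ hW f κ 2) a x))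
      (K.M ∘ₗ J (a * vqAlg φ hW f κ 2) ∘ₗ J a) (fun _ => rfl),
    sum_vv ha hu (by norm_num) (by omega) (by omega)
      (fun x => mean (ren ↑(a * vqAlg φ hW f κ 2) x))
      (K.M ∘ₗ J (a * vqAlg φ hW f κ 2)) (fun _ => rfl)]
  rfl

/-- The primitive of a Cauchy product with mean value zero. -/
theorem I_cauchy_apply {m : ℕ} (ha : (a : ℝ → ℂ) = Q0 f)
    (hu : ∀ p, 1 ≤ p → p < m → vq f κ p ∈ expAlgebra φ hW)
    (hm : (expCalculus φ hW hdiv).M (a * MeanCalculus.cauchy (vqAlg φ hW f κ) 1 m) = 0) (t : ℝ) :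
    (((expCalculus φ hW hdiv).I (a * MeanCalculus.cauchy (vqAlg φ hW f κ) 1 m) :
      expAlgebra φ hW) : ℝ → ℂ) t =
      ∫ τ in (0 : ℝ)..t, ∑ p ∈ Finset.Ico 1 m, v f κ p τ * v f κ (m - p) τ := by
  rw [prim_coe, prim, mean_coe (hdiv := hdiv), hm]
  simp only [sub_zero, coe_cauchy ha hu le_rfl (Nat.lt_succ_self m), Nat.add_sub_cancel]

theorem vq_eq {m : ℕ} (hm3 : 3 ≤ m) (ha : (a : ℝ → ℂ) = Q0 f)
    (hu : ∀ p, 1 ≤ p → p < m → vq f κ p ∈ expAlgebra φ hW)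
    (hm : (expCalculus φ hW hdiv).M (a * MeanCalculus.cauchy (vqAlg φ hW f κ) 1 m) = 0) :
    vq f κ m = ((Complex.I • (expCalculus φ hW hdiv).I
      (a * MeanCalculus.cauchy (vqAlg φ hW f κ) 1 m) + κ m • (1 : expAlgebra φ hW) :
        expAlgebra φ hW) : ℝ → ℂ) := by
  funext t
  rw [vq, v_eq f κ m hm3, inv_mul_cancel_left₀ (q_ne_zero f t), ← I_cauchy_apply ha hu hm]
  simp

theorem vq_one (κ : ℕ → ℂ) : vq f κ 1 = ((κ 1 • (1 : expAlgebra φ hW) : expAlgebra φ hW) :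
    ℝ → ℂ) := by
  funext t
  rw [vq, v_one, mul_comm (κ 1), inv_mul_cancel_left₀ (q_ne_zero f t)]
  simp

theorem vq_two (ha : (a : ℝ → ℂ) = Q0 f) (hb : (b : ℝ → ℂ) = fun t => (Q0 f t)⁻¹)
    (ma : (expCalculus φ hW hdiv).M a = 0) (mb : (expCalculus φ hW hdiv).M b = 0) :
    vq f κ 2 = (((Complex.I * κ 1 ^ 2) • (expCalculus φ hW hdiv).I a
      - Complex.I • (expCalculus φ hW hdiv).I b + κ 2 • (1 : expAlgebra φ hW) :
        expAlgebra φ hW) : ℝ → ℂ) := by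
  funext t
  have h : ∫ τ in (0 : ℝ)..t, (κ 1 ^ 2 * Q0 f τ - (Q0 f τ)⁻¹) =
      κ 1 ^ 2 * prim (a : ℝ → ℂ) t - prim (b : ℝ → ℂ) t := by
    rw [prim, prim, mean_coe (hdiv := hdiv), mean_coe (hdiv := hdiv), ma, mb,
      ← intervalIntegral.integral_const_mul, ← intervalIntegral.integral_sub]
    · simp only [sub_zero, ha, hb]
    · exact (continuous_const.mul
        ((Rep.continuous a.2).sub continuous_const)).intervalIntegrable _ _
    · exact ((Rep.continuous b.2).sub continuous_const).intervalIntegrable _ _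
  rw [vq, v_two, inv_mul_cancel_left₀ (q_ne_zero f t), h]
  simp [prim_coe]
  ring

/-- For a secular-free choice of the integration constants, all `v_n / q` are exponential sums and
the integrands in the recursion have mean value zero. -/
theorem vq_mem (ha : (a : ℝ → ℂ) = Q0 f) (hb : (b : ℝ → ℂ) = fun t => (Q0 f t)⁻¹)
    (hdiv : ∀ γ, φ γ ≠ 0 → 1 / W γ ≤ |φ γ|)
    (h0 : mean (Q0 f) = 0) (h1 : mean (Q1 f) = 0) (h3 : mean (Q3 f) ≠ 0)
    (hκ : IsSecularFreeChoice f κ) (n : ℕ) (hn : 1 ≤ n) : vq f κ n ∈ expAlgebra φ hW ∧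
      (3 ≤ n → (expCalculus φ hW hdiv).M
        (a * MeanCalculus.cauchy (vqAlg φ hW f κ) 1 n) = 0) := by
  set K := expCalculus φ hW hdiv with hK
  have ma : K.M a = 0 := by rw [← h0, ← ha]; rfl
  have mb : K.M b = 0 := by
    have : (b : ℝ → ℂ) = fun t => (starRingEnd ℂ) ((a : ℝ → ℂ) t) := by
      rw [ha, hb]; exact funext fun t => (conj_Q0 f t).symm
    rw [← mean_coe, this, Rep.mean_conj a.2, ha, h0, map_zero]
  have mQ1 : K.M (a * K.I b) = 0 := by
    rw [← h1, Q1_coe (hdiv := hdiv) ha hb]; rfl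
  have hμ : K.M (a * K.I (a * K.I b)) = mean (Q3 f) := by
    rw [Q3_coe (hdiv := hdiv) ha hb]; rfl
  have hab : a * b = 1 := by
    refine Subtype.ext (funext fun t => ?_)
    simp [ha, hb, mul_inv_cancel₀ (Q0_ne_zero f t)]
  have hk1 : κ 1 ≠ 0 := by
    intro h
    have := hκ.kappa1
    rw [h, zero_pow two_ne_zero, eq_comm, div_eq_zero_iff] at this
    rcases this with h | h
    · exact h3 ((map_eq_zero _).1 h)
    · exact h3 h
  -- Membership at n ≥ 3 requires the vanishing mean at n, which requires the abstract recursion,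
  -- hence both statements, below n.
  induction n using Nat.strong_induction_on with
  | _ n ih =>
  have hu : ∀ p, 1 ≤ p → p < n → vq f κ p ∈ expAlgebra φ hW := fun p hp hpn => (ih p hpn hp).1
  have hrec : 1 < n → K.Recursion a b κ (vqAlg φ hW f κ) n := fun hn1 =>
    { mul_eq_one := hab
      mean_a := ma
      mean_b := mb
      mean_Q1 := mQ1
      one := Subtype.ext (by rw [coe_vqAlg (hu 1 le_rfl hn1)]; exact vq_one κ)
      two := fun h2 => Subtype.ext (by
        rw [coe_vqAlg (hu 2 (by norm_num) h2)]; exact vq_two ha hb ma mb)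
      step := fun m hm3 hmn => Subtype.ext (by
        rw [coe_vqAlg (hu m (by omega) hmn)]
        exact vq_eq hm3 ha (fun p hp hpm => hu p hp (by omega)) ((ih m hmn (by omega)).2 hm3)) }
  have hmean : 3 ≤ n → K.M (a * MeanCalculus.cauchy (vqAlg φ hW f κ) 1 n) = 0 := by
    intro hn3
    have hr := hrec (by omega)
    rcases (by omega : n = 3 ∨ n = 4 ∨ n = 5 ∨ n = 6 ∨ 7 ≤ n) with h | h | h | h | h
    · exact hr.mean_three h
    · refine hr.mean_four h ?_
      rw [mean_conj_Q3 ha hb, hμ, hκ.kappa1, div_mul_cancel₀ _ h3]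
    · refine hr.mean_five h ?_
      rw [hμ, hκ.kappa2, A1_coe (hdiv := hdiv) ha hb, mean_coe (hdiv := hdiv),
        mul_div_cancel₀ _ (mul_ne_zero two_ne_zero h3)]
    · refine hr.mean_six h ?_
      have hne : 4 * κ 1 * mean (Q3 f) ≠ 0 :=
        mul_ne_zero (mul_ne_zero (by norm_num) hk1) h3
      rw [hμ, hκ.kappa3, A2_coe (hdiv := hdiv) ha hb,
        A3_coe (hdiv := hdiv) ha hb (hu 2 (by norm_num) (by omega)),
        A4_coe (hdiv := hdiv) ha hb, mean_coe (hdiv := hdiv), mean_coe (hdiv := hdiv),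
        mean_coe (hdiv := hdiv), mul_div_cancel₀ _ hne]
    · refine hr.mean_of_seven_le h (by rw [hμ]; exact mul_ne_zero hk1 h3) ?_
      have hl : (fun t => (q f t)⁻¹ * v f κ 3 t * l f κ (n - 3) t) =
          ((vqAlg φ hW f κ 3 * (a * (Complex.I • K.I
            (a * MeanCalculus.cauchy (vqAlg φ hW f κ) 1 (n - 3)))) : expAlgebra φ hW) :
              ℝ → ℂ) := by
        funext t
        rw [l, ← I_cauchy_apply (hdiv := hdiv) ha (fun p hp hpm => hu p hp (by omega))
          ((ih (n - 3) (by omega) (by omega)).2 (by omega))]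
        simp only [Subalgebra.coe_mul, Pi.mul_apply, coe_vqAlg (hu 3 (by norm_num) (by omega)), ha,
          Q0, Subalgebra.coe_smul, Pi.smul_apply, smul_eq_mul, vq]
        ring
      rw [hμ, hκ.recursion n h, R1_coe (hdiv := hdiv) h ha hb hu, R2_coe (hdiv := hdiv) h ha hu, hl,
        sum_vv ha hu (by norm_num) (by omega) (by omega) mean K.M (fun _ => rfl)]
      rfl
  refine ⟨?_, hmean⟩
  rcases (by omega : n = 1 ∨ n = 2 ∨ 3 ≤ n) with h | h | h
  · subst h
    rw [vq_one (φ := φ) (hW := hW)]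
    exact Subtype.property _
  · subst h
    rw [vq_two ha hb ma mb]
    exact Subtype.property _
  · rw [vq_eq h ha hu (hmean h)]
    exact Subtype.property _

end Assembly

/-! ### Conclusions for κ₁ and the v_n. -/

theorem norm_kappa_one {f : ℝ → ℝ} {κ : ℕ → ℂ} (h3 : mean (Q3 f) ≠ 0)
    (hκ : IsSecularFreeChoice f κ) : ‖κ 1‖ = 1 := by
  have h := congrArg norm hκ.kappa1
  rw [norm_pow, norm_div, Complex.norm_conj, div_self (norm_ne_zero_iff.2 h3)] at h
  exact (pow_eq_one_iff_of_nonneg (norm_nonneg _) two_ne_zero).1 h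

theorem isQuasiPeriodic_v {A : ℕ} {f : ℝ → ℝ} {ω : Fin A → ℝ} {F : (Fin A → ℤ) → ℂ}
    {w : (Fin A → ℤ) → ℝ} (hf : HasFourierExpansion (fun t => (f t : ℂ)) ω F)
    (hw : SmallDivisorControl f ω F w) (h0 : mean (Q0 f) = 0) (h1 : mean (Q1 f) = 0)
    (h3 : mean (Q3 f) ≠ 0) {κ : ℕ → ℂ} (hκ : IsSecularFreeChoice f κ) {n : ℕ} (hn : 1 ≤ n) :
    IsQuasiPeriodic (v f κ n) := by
  obtain ⟨m, hm⟩ := exists_resonance hf hw h3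
  have hc := hw.one_le m
  have hW := isWeight_weightExt hw.isWeight hc
  let φ := freqExt ω (mean fun t => (f t : ℂ)).re
  let a : expAlgebra φ hW := ⟨Q0 f, (rep_Q0 hf hw hc).mono (Set.subset_univ _)⟩
  let b : expAlgebra φ hW := ⟨fun t => (Q0 f t)⁻¹, (rep_Q0_inv hf hw hc).mono (Set.subset_univ _)⟩
  have hmem := (vq_mem (a := a) (b := b) rfl rfl (divisor_of_resonance hf hw hm) h0 h1 h3 hκ n
    hn).1
  -- The factor exp(iθt) of q is split off; the rest is an exponential sum with frequencies m·ω +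
  -- 2kθ.
  have hv : v f κ n = fun t => expo (mean fun t => (f t : ℂ)).re t *
      (Complex.exp (Complex.I * prim (fun t => (f t : ℂ)) t) * vq f κ n t) := by
    funext t
    rw [v_eq_vq, q_eq hf hw]
    ring
  rw [hv]
  exact ((rep_exp_prim hf hw hc Complex.I).mul hW hmem).isQuasiPeriodic

end QPRiccati

theorem mainTheorem1 {A : ℕ} (f : ℝ → ℝ) (ω : Fin A → ℝ) (F : (Fin A → ℤ) → ℂ)
    (w : (Fin A → ℤ) → ℝ)
    (hf : QPRiccati.HasFourierExpansion (fun t => (f t : ℂ)) ω F)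
    (hw : QPRiccati.SmallDivisorControl f ω F w)
    (h0 : QPRiccati.mean (QPRiccati.Q0 f) = 0)
    (h1 : QPRiccati.mean (QPRiccati.Q1 f) = 0)
    (h3 : QPRiccati.mean (QPRiccati.Q3 f) ≠ 0) :
    (∀ c : ℂ, c ^ 2 = (starRingEnd ℂ) (QPRiccati.mean (QPRiccati.Q3 f)) /
        QPRiccati.mean (QPRiccati.Q3 f) →
      ∃ κ : ℕ → ℂ, κ 1 = c ∧ QPRiccati.IsSecularFreeChoice f κ) ∧
    (∃ κ : ℕ → ℂ, QPRiccati.IsSecularFreeChoice f κ) ∧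
    ∀ κ : ℕ → ℂ, QPRiccati.IsSecularFreeChoice f κ →
      ‖κ 1‖ = 1 ∧
      (∀ n : ℕ, 1 ≤ n → QPRiccati.IsQuasiPeriodic (QPRiccati.v f κ n)) ∧
      (∀ n : ℕ, 1 ≤ n → ∀ t : ℝ, HasDerivAt (QPRiccati.g f κ n)
        (Complex.I * (∑ p ∈ Finset.Ico 1 n, QPRiccati.g f κ p t * QPRiccati.g f κ (n - p) t)
          + 2 * Complex.I * (f t : ℂ) * QPRiccati.g f κ n t
          - (if n = 2 then Complex.I else 0)) t) := by
  refine ⟨fun c hc => ⟨_, QPRiccati.isSecularFreeChoice_kappaSeq f hc⟩, ?_, fun κ hκ =>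
    ⟨QPRiccati.norm_kappa_one h3 hκ,
      fun n hn => QPRiccati.isQuasiPeriodic_v hf hw h0 h1 h3 hκ hn,
      fun n hn t => QPRiccati.hasDerivAt_g (QPRiccati.continuous_of_control hf hw) κ hn t⟩⟩
  obtain ⟨c, hc⟩ := IsAlgClosed.exists_pow_nat_eq
    ((starRingEnd ℂ) (QPRiccati.mean (QPRiccati.Q3 f)) / QPRiccati.mean (QPRiccati.Q3 f))
    two_pos
  exact ⟨_, (QPRiccati.isSecularFreeChoice_kappaSeq f hc).2⟩
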